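/- Let $\alpha,\beta>-1$ be real numbers with $a:=\frac{\alpha+\beta+1}{2}>0$, let $w(x)=(1-x)^\alpha(1+x)^\beta$ be the Jacobi weight on $\mathbb I=[-1,1]$, and let $L_2(\mathbb I,w)$ be the Hilbert space of real-valued functions that are square integrable with respect to $w(x)\,dx$. For $k\in\mathbb N_0$ let $$P_k(x)=\sum_{j=0}^{k}\binom{k+\alpha}{k-j}\binom{k+\beta}{j}\Big(\frac{x-1}{2}\Big)^{j}\Big(\frac{x+1}{2}\Big)^{k-j}$$ be the $k$th Jacobi polynomial and $p_k=P_k/\|P_k\|_{L_2(\mathbb I,w)}$. For $d\in\mathbb N$, $d\ge 1$, let $w_d(x)=\prod_{j=1}^d w(x_j)$ on $\mathbb I^d$. The tensor products $p_{\boldsymbol k}(x)=\prod_{j=1}^d p_{k_j}(x_j)$, $\boldsymbol k\in\mathbb N_0^d$, form an orthonormal basis of $L_2(\mathbb I^d,w_d)$; write $f_{\boldsymbol k}=\int_{\mathbb I^d} f\,p_{\boldsymbol k}\,w_d\,dx$. For $s>0$ let $K^s(\mathbb I^d,w_d)$ be the Hilbert space of all $f\in L_2(\mathbb I^d,w_d)$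 with $$\sum_{\boldsymbol k\in\mathbb N_0^d}\ \prod_{j=1}^d\big(1+a^{-1}k_j\big)^{2s}\,f_{\boldsymbol k}^2<\infty,\qquad \langle f,g\rangle_s=\sum_{\boldsymbol k\in\mathbb N_0^d}\ \prod_{j=1}^d\big(1+a^{-1}k_j\big)^{2s}\,f_{\boldsymbol k}\,g_{\boldsymbol k};$$ it is the $d$th Hilbert space tensor power of $K^s(\mathbb I,w)$. For a bounded operator $T:X\to Y$ between Hilbert spaces let $a_n(T)=\inf\{\|T-A\| : A\in\mathcal L(X,Y),\ \operatorname{rank}A<n\}$ be its $n$th approximation number. Then, for every $d\ge 1$ and every $s>0$, the following limit exists and has the stated value: $$\lim_{n\to\infty} a_n\big(K^s(\mathbb I^d,w_d)\hookrightarrow L_2(\mathbb I^d,w_d)\big)\cdot n^{s}\,(\log n)^{-s(d-1)}=\left(\frac{a^d}{(d-1)!}\right)^{s}.$$ -/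

import Mathlib

noncomputable section

open MeasureTheory Polynomial
open scoped ENNReal

namespace Jacobi

/-- Parameters `α, β > -1` with `a = (α + β + 1) / 2 > 0`. -/
structure Param where
  α : ℝ
  β : ℝ
  hα : -1 < α
  hβ : -1 < β
  ha : 0 < (α + β + 1) / 2

/-- `a = (α + β + 1) / 2`. -/
def Param.a (p : Param) : ℝ := (p.α + p.β + 1) / 2

/-- The Jacobi weight `w(x) = (1 - x) ^ α (1 + x) ^ β`. -/
def weight (p : Param) (x : ℝ) : ℝ := (1 - x) ^ p.α * (1 + x) ^ p.β

/-- The measure `w(x) dx` on the interval `[-1, 1]`. -/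
def measure (p : Param) : Measure ℝ :=
  (volume.restrict (Set.Icc (-1) 1)).withDensity fun x => ENNReal.ofReal (weight p x)

/-- The cube `[-1, 1] ^ d`. -/
def cube (d : ℕ) : Set (Fin d → ℝ) := Set.univ.pi fun _ => Set.Icc (-1) 1

/-- The measure `w_d(x) dx` on the cube `[-1, 1] ^ d`, where `w_d = w ⊗ ⋯ ⊗ w`. -/
def cubeMeasure (p : Param) (d : ℕ) : Measure (Fin d → ℝ) :=
  (volume.restrict (cube d)).withDensity fun x => ENNReal.ofReal (∏ j, weight p (x j))

/-- The Jacobi polynomial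
`P_k(x) = ∑_j binom(k + α, k - j) binom(k + β, j) ((x - 1) / 2) ^ j ((x + 1) / 2) ^ (k - j)`. -/
def poly (p : Param) (k : ℕ) : ℝ[X] :=
  ∑ j ∈ Finset.range (k + 1),
    C (Ring.choose ((k : ℝ) + p.α) (k - j) * Ring.choose ((k : ℝ) + p.β) j) *
      ((C 2⁻¹ * (X - 1)) ^ j * (C 2⁻¹ * (X + 1)) ^ (k - j))

/-- The norm of the Jacobi polynomial `P_k` in `L_2([-1, 1], w)`. -/
def polyNorm (p : Param) (k : ℕ) : ℝ := √(∫ x, (poly p k).eval x ^ 2 ∂measure p)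

/-- The normalized Jacobi polynomials. -/
def basisFun (p : Param) (k : ℕ) (x : ℝ) : ℝ := (polyNorm p k)⁻¹ * (poly p k).eval x

/-! ### Endpoint values, differential equation, orthogonality -/

lemma choose_eq_prod (r : ℝ) (n : ℕ) :
    Ring.choose r n = (∏ i ∈ Finset.range n, (r - i)) / n.factorial := by
  have h : ∀ m : ℕ, (descPochhammer ℤ m).smeval r = ∏ i ∈ Finset.range m, (r - i) := by
    intro m
    induction m with
    | zero => simp
    | succ m ih =>
      rw [descPochhammer_succ_right, smeval_mul, ih, Finset.prod_range_succ]
      simp [smeval_sub, smeval_natCast]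
  rw [Ring.choose_eq_smul, h, smul_eq_mul]
  ring

lemma choose_pos {r : ℝ} {k n : ℕ} (hr : (k : ℝ) - 1 < r) (hn : n ≤ k) : 0 < Ring.choose r n := by
  rw [choose_eq_prod]
  refine div_pos (Finset.prod_pos fun i hi => ?_) (by positivity)
  have : (i : ℝ) + 1 ≤ k := by exact_mod_cast (Finset.mem_range.1 hi).trans_le hn
  linarith

lemma choose_mul_Gamma {r : ℝ} {k n : ℕ} (hr : (k : ℝ) - 1 < r) (hn : n ≤ k) :
    Ring.choose r n * Real.Gamma (r - n + 1) = Real.Gamma (r + 1) / n.factorial := by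
  rw [choose_eq_prod, div_mul_eq_mul_div]
  congr 1
  induction n with
  | zero => simp
  | succ n ih =>
    rw [← ih (by omega), Finset.prod_range_succ]
    have : (n : ℝ) + 1 ≤ k := by exact_mod_cast hn
    rw [Real.Gamma_add_one (s := r - n) (by linarith)]
    push_cast
    rw [show r - (n + 1) + 1 = r - n by ring]
    ring

lemma poly_eval (p : Param) (k : ℕ) (x : ℝ) :
    (poly p k).eval x = ∑ j ∈ Finset.range (k + 1),
      Ring.choose ((k : ℝ) + p.α) (k - j) * Ring.choose ((k : ℝ) + p.β) j *
        (((x - 1) / 2) ^ j * ((x + 1) / 2) ^ (k - j)) := by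
  simp only [poly, eval_finsetSum, eval_mul, eval_C, eval_pow, eval_sub, eval_X, eval_one,
    eval_add]
  refine Finset.sum_congr rfl fun j _ => ?_
  congr 3 <;> ring

theorem poly_eval_one (p : Param) (k : ℕ) :
    (poly p k).eval 1 = Ring.choose ((k : ℝ) + p.α) k := by
  rw [poly_eval, Finset.sum_eq_single 0]
  · simp
  · intro j _ hj; simp [hj]
  · simp

theorem poly_eval_neg_one (p : Param) (k : ℕ) :
    (poly p k).eval (-1) = (-1) ^ k * Ring.choose ((k : ℝ) + p.β) k := by
  rw [poly_eval, Finset.sum_eq_single k]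
  · norm_num; ring
  · intro j hj hjk
    have : k - j ≠ 0 := by have := Finset.mem_range.1 hj; omega
    simp [this]
  · simp

lemma poly_natDegree_coeff (p : Param) (k : ℕ) :
    (poly p k).natDegree ≤ k ∧ 0 < (poly p k).coeff k := by
  have hmon : ∀ j ∈ Finset.range (k + 1), ((X - 1) ^ j * (X + 1) ^ (k - j) : ℝ[X]).Monic ∧
      ((X - 1) ^ j * (X + 1) ^ (k - j) : ℝ[X]).natDegree = k := by
    intro j hj
    have h1 : (X - 1 : ℝ[X]).Monic := by simpa using monic_X_sub_C (1 : ℝ)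
    have h2 : (X + 1 : ℝ[X]).Monic := by simpa using monic_X_add_C (1 : ℝ)
    have d1 : (X - 1 : ℝ[X]).natDegree = 1 := by simpa using natDegree_X_sub_C (1 : ℝ)
    have d2 : (X + 1 : ℝ[X]).natDegree = 1 := by simpa using natDegree_X_add_C (1 : ℝ)
    refine ⟨(h1.pow j).mul (h2.pow _), ?_⟩
    rw [(h1.pow j).natDegree_mul (h2.pow _), h1.natDegree_pow, h2.natDegree_pow, d1, d2]
    have := Finset.mem_range.1 hj; omega
  have hP : poly p k = ∑ j ∈ Finset.range (k + 1),
      C (Ring.choose ((k : ℝ) + p.α) (k - j) * Ring.choose ((k : ℝ) + p.β) j * 2⁻¹ ^ k) *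
        ((X - 1) ^ j * (X + 1) ^ (k - j)) := by
    refine Finset.sum_congr rfl fun j hj => ?_
    have hj : j + (k - j) = k := by have := Finset.mem_range.1 hj; omega
    have h2 : (C (2⁻¹ ^ k) : ℝ[X]) = C 2⁻¹ ^ j * C 2⁻¹ ^ (k - j) := by
      rw [← pow_add, hj, C_pow]
    rw [mul_pow, mul_pow, C_mul, C_mul, C_mul, h2]
    ring
  constructor
  · rw [hP]
    refine natDegree_sum_le_of_forall_le _ _ fun j hj => ?_
    exact (natDegree_C_mul_le _ _).trans (hmon j hj).2.le
  · rw [hP, finsetSum_coeff]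
    refine Finset.sum_pos (fun j hj => ?_) ⟨0, by simp⟩
    have h1 : ((X - 1) ^ j * (X + 1) ^ (k - j) : ℝ[X]).coeff k = 1 := by
      have := (hmon j hj).1.coeff_natDegree
      rwa [(hmon j hj).2] at this
    have hj' : j ≤ k := by have := Finset.mem_range.1 hj; omega
    rw [coeff_C_mul, h1, mul_one]
    have := choose_pos (r := (k : ℝ) + p.α) (k := k) (n := k - j) (by linarith [p.hα]) (by omega)
    have := choose_pos (r := (k : ℝ) + p.β) (k := k) (n := j) (by linarith [p.hβ]) hj'
    positivity

lemma poly_degree (p : Param) (k : ℕ) : (poly p k).degree = k := by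
  obtain ⟨h1, h2⟩ := poly_natDegree_coeff p k
  exact le_antisymm (natDegree_le_iff_degree_le.1 h1) (le_degree_of_ne_zero h2.ne')

lemma poly_ne_zero (p : Param) (k : ℕ) : poly p k ≠ 0 := by
  intro h
  have := (poly_natDegree_coeff p k).2
  simp [h] at this

lemma span_poly (p : Param) : Submodule.span ℝ (Set.range (poly p)) = ⊤ :=
  Polynomial.Sequence.span ⟨poly p, poly_degree p⟩ fun i =>
    (leadingCoeff_ne_zero.2 (poly_ne_zero p i)).isUnit

lemma map_eq_zero_of_degree_lt (k : ℕ) (q : ℝ[X]) (hq : q.degree < k) (φ : ℝ[X] →ₗ[ℝ] ℝ)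
    (h : ∀ m < k, φ ((1 - X) ^ m) = 0) : φ q = 0 := by
  have : q = ((q.comp (1 - X)).comp (1 - X)) := by
    rw [comp_assoc]; simp
  rw [this, comp_eq_sum_left, Polynomial.sum, map_sum]
  refine Finset.sum_eq_zero fun m hm => ?_
  rw [C_mul', map_smul, h m, smul_zero]
  have h1 : m ≤ (q.comp (1 - X)).natDegree := le_natDegree_of_mem_supp _ hm
  have h2 : (1 - X : ℝ[X]).natDegree = 1 := by
    rw [← neg_sub, natDegree_neg]; simpa using natDegree_X_sub_C (1 : ℝ)
  rw [natDegree_comp, h2, mul_one] at h1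
  have hq0 : q ≠ 0 := by rintro rfl; simp at hm
  exact h1.trans_lt ((natDegree_lt_iff_degree_lt hq0).2 hq)

lemma beta01 {a b : ℝ} (ha : 0 < a) (hb : 0 < b) :
    IntervalIntegrable (fun x : ℝ => x ^ (a - 1) * (1 - x) ^ (b - 1)) volume 0 1 ∧
    ∫ x in (0:ℝ)..1, x ^ (a - 1) * (1 - x) ^ (b - 1) =
      Real.Gamma a * Real.Gamma b / Real.Gamma (a + b) := by
  have hc := Complex.betaIntegral_convergent (u := (a : ℂ)) (v := (b : ℂ)) (by simpa) (by simpa)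
  have key : ∀ x ∈ Set.Ioc (0:ℝ) 1, (((x : ℂ)) ^ ((a : ℂ) - 1) * (1 - (x : ℂ)) ^ ((b : ℂ) - 1)).re
      = x ^ (a - 1) * (1 - x) ^ (b - 1) := by
    rintro x ⟨hx1, hx2⟩
    norm_cast
    rw [← Complex.ofReal_cpow hx1.le, ← Complex.ofReal_cpow (by linarith),
      ← Complex.ofReal_mul, Complex.ofReal_re]
  rw [intervalIntegrable_iff_integrableOn_Ioc_of_le zero_le_one] at hc ⊢
  refine ⟨(hc.re).congr ?_, ?_⟩
  · exact (ae_restrict_iff' measurableSet_Ioc).2 (Filter.Eventually.of_forall key)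
  · have := ProbabilityTheory.beta_eq_betaIntegralReal a b ha hb
    rw [ProbabilityTheory.beta] at this
    rw [this, Complex.betaIntegral, intervalIntegral.integral_of_le zero_le_one,
      intervalIntegral.integral_of_le zero_le_one, ← RCLike.re_eq_complex_re, ← integral_re hc]
    exact setIntegral_congr_fun measurableSet_Ioc fun x hx => (key x hx).symm

lemma beta_interval {u v : ℝ} (hu : -1 < u) (hv : -1 < v) :
    IntervalIntegrable (fun x : ℝ => (1 - x) ^ u * (1 + x) ^ v) volume (-1) 1 ∧
    ∫ x in (-1:ℝ)..1, (1 - x) ^ u * (1 + x) ^ v =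
      2 ^ (u + v + 1) * (Real.Gamma (u + 1) * Real.Gamma (v + 1) / Real.Gamma (u + v + 2)) := by
  obtain ⟨h1, h2⟩ := beta01 (a := v + 1) (b := u + 1) (by linarith) (by linarith)
  simp only [add_sub_cancel_right] at h1 h2
  have key : ∀ x ∈ Set.Icc (0:ℝ) 1, (1 - (2 * x + -1)) ^ u * (1 + (2 * x + -1)) ^ v =
      2 ^ (u + v) * (x ^ v * (1 - x) ^ u) := by
    rintro x ⟨hx0, hx1⟩
    rw [show 1 - (2 * x + -1) = 2 * (1 - x) by ring, show 1 + (2 * x + -1) = 2 * x by ring,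
      Real.mul_rpow (by norm_num) (by linarith), Real.mul_rpow (by norm_num) hx0,
      Real.rpow_add (by norm_num)]
    ring
  constructor
  · have h3 : IntervalIntegrable (fun x : ℝ => (1 - (2 * x + -1)) ^ u * (1 + (2 * x + -1)) ^ v)
        volume 0 1 := by
      refine (h1.const_mul (2 ^ (u + v))).congr ?_
      intro x hx
      rw [Set.uIoc_of_le zero_le_one] at hx
      exact (key x (Set.Ioc_subset_Icc_self hx)).symm
    have h4 := (h3.comp_mul_left (c := 1 / 2)).comp_add_right 1
    convert h4 using 1
    · ext x; congr 2 <;> ring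
    · norm_num
    · norm_num
  · have h3 := intervalIntegral.integral_comp_mul_add (a := 0) (b := 1) (c := 2)
      (fun x : ℝ => (1 - x) ^ u * (1 + x) ^ v) two_ne_zero (-1)
    norm_num at h3
    have h4 : ∫ x in (0:ℝ)..1, (1 - (2 * x + -1)) ^ u * (1 + (2 * x + -1)) ^ v =
        2 ^ (u + v) * ∫ x in (0:ℝ)..1, x ^ v * (1 - x) ^ u := by
      rw [← intervalIntegral.integral_const_mul]
      refine intervalIntegral.integral_congr fun x hx => ?_
      rw [Set.uIcc_of_le zero_le_one] at hx
      exact key x hx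
    rw [h2] at h4
    rw [Real.rpow_add_one two_ne_zero, show u + v + 2 = v + 1 + (u + 1) by ring]
    have h5 : ∫ x in (-1:ℝ)..1, (1 - x) ^ u * (1 + x) ^ v =
        2 * ∫ x in (0:ℝ)..1, (1 - (2 * x + -1)) ^ u * (1 + (2 * x + -1)) ^ v := by
      norm_num
      linarith
    rw [h5, h4]
    ring

lemma measurable_weight (p : Param) : Measurable (weight p) := by
  unfold weight; fun_prop

lemma weight_nonneg (p : Param) {x : ℝ} (hx : x ∈ Set.Icc (-1 : ℝ) 1) : 0 ≤ weight p x :=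
  mul_nonneg (Real.rpow_nonneg (by linarith [hx.2]) _) (Real.rpow_nonneg (by linarith [hx.1]) _)

lemma integrableOn_weight (p : Param) : IntegrableOn (weight p) (Set.Icc (-1) 1) := by
  have := (beta_interval p.hα p.hβ).1
  rw [intervalIntegrable_iff_integrableOn_Icc_of_le (by norm_num)] at this
  exact this

instance (p : Param) : IsFiniteMeasure (measure p) :=
  isFiniteMeasure_withDensity_ofReal (integrableOn_weight p).2

lemma integral_measure (p : Param) (f : ℝ → ℝ) :
    ∫ x, f x ∂measure p = ∫ x in (-1)..1, weight p x * f x := by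
  rw [measure, integral_withDensity_eq_integral_toReal_smul (measurable_weight p).ennreal_ofReal
    (by simp), intervalIntegral.integral_of_le (by norm_num), integral_Icc_eq_integral_Ioc]
  refine setIntegral_congr_fun measurableSet_Ioc fun x hx => ?_
  simp only [smul_eq_mul]
  rw [ENNReal.toReal_ofReal (weight_nonneg p (Set.Ioc_subset_Icc_self hx))]

lemma measure_compl (p : Param) : measure p (Set.Icc (-1) 1)ᶜ = 0 :=
  withDensity_absolutelyContinuous _ _ (by simp [Measure.restrict_apply])

lemma measure_ae_mem (p : Param) : ∀ᵐ x ∂measure p, x ∈ Set.Icc (-1 : ℝ) 1 :=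
  measure_compl p

lemma integrable_measure (p : Param) {f : ℝ → ℝ} (hf : Continuous f) :
    Integrable f (measure p) := by
  obtain ⟨c, hc⟩ := isCompact_Icc.exists_bound_of_continuousOn (s := Set.Icc (-1 : ℝ) 1)
    hf.continuousOn
  refine Integrable.of_bound hf.aestronglyMeasurable c ?_
  filter_upwards [measure_ae_mem p] with x hx using hc x hx

lemma ascPochhammer_Gamma {s : ℝ} (hs : 0 < s) (m : ℕ) :
    Real.Gamma (s + m) = (ascPochhammer ℝ m).eval s * Real.Gamma s := by
  induction m with
  | zero => simp
  | succ m ih =>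
    push_cast
    rw [← add_assoc, Real.Gamma_add_one (by positivity), ih, ascPochhammer_succ_eval]
    ring

lemma alternating_sum_eq_zero {k : ℕ} {q : ℝ[X]} (hq : q.natDegree < k) :
    ∑ j ∈ Finset.range (k + 1), (-1 : ℝ) ^ j * (k.choose j : ℝ) * q.eval (j : ℝ) = 0 := by
  have h := congrFun (Polynomial.fwdDiff_iter_eq_zero_of_degree_lt hq) 0
  rw [fwdDiff_iter_eq_sum_shift] at h
  simp only [zero_add, nsmul_eq_mul, mul_one, zsmul_eq_mul, Pi.zero_apply] at h
  push_cast at h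
  rw [← mul_zero ((-1 : ℝ) ^ k), ← h, Finset.mul_sum]
  refine Finset.sum_congr rfl fun j hj => ?_
  have hj' : k = (k - j) + j := by have := Finset.mem_range.1 hj; omega
  have h2 : (-1 : ℝ) ^ k * (-1) ^ (k - j) = (-1) ^ j := by
    conv_lhs => rw [hj']
    simp only [Nat.add_sub_cancel]
    rw [pow_add]
    rcases neg_one_pow_eq_or ℝ (k - j) with h | h <;> rw [h] <;> ring
  rw [← mul_assoc, ← mul_assoc, h2]

lemma integral_poly_mul_pow (p : Param) {k m : ℕ} (hm : m < k) :
    ∫ x, (poly p k).eval x * (1 - x) ^ m ∂measure p = 0 := by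
  rw [integral_measure]
  have hα := p.hα
  have hβ := p.hβ
  set A := p.α
  set B := p.β
  have hI : ∀ j ∈ Finset.range (k + 1),
      IntervalIntegrable (fun x : ℝ => (1 - x) ^ (A + j + m) * (1 + x) ^ (B + (k - j : ℕ)))
        volume (-1) 1 ∧ ∫ x in (-1:ℝ)..1, (1 - x) ^ (A + j + m) * (1 + x) ^ (B + (k - j : ℕ)) =
      2 ^ (A + B + m + k + 1) * (Real.Gamma (A + j + m + 1) * Real.Gamma (B + (k - j : ℕ) + 1) /
        Real.Gamma (A + B + m + k + 2)) := by
    intro j hj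
    have h0 : (0 : ℝ) ≤ (k - j : ℕ) := by positivity
    have h := beta_interval (u := A + j + m) (v := B + (k - j : ℕ))
      (by have : (0:ℝ) ≤ (j:ℝ) + m := by positivity
          linarith) (by linarith)
    have hj' : ((k - j : ℕ) : ℝ) = k - j := by
      rw [Nat.cast_sub]; have := Finset.mem_range.1 hj; omega
    have e : A + j + m + (B + (k - j : ℕ)) = A + B + m + k := by rw [hj']; ring
    rwa [e] at h
  have h1 : ∀ x ∈ Set.Ioo (-1 : ℝ) 1, weight p x * ((poly p k).eval x * (1 - x) ^ m) =
      ∑ j ∈ Finset.range (k + 1), (2⁻¹ ^ k * (-1) ^ j * (Ring.choose ((k : ℝ) + A) (k - j) *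
        Ring.choose ((k : ℝ) + B) j)) * ((1 - x) ^ (A + j + m) * (1 + x) ^ (B + (k - j : ℕ))) := by
    intro x hx
    have hx1 : 0 < 1 - x := by linarith [hx.2]
    have hx2 : 0 < 1 + x := by linarith [hx.1]
    rw [poly_eval, weight, Finset.sum_mul, Finset.mul_sum]
    refine Finset.sum_congr rfl fun j hj => ?_
    have hj' : j + (k - j) = k := by have := Finset.mem_range.1 hj; omega
    have h2 : (2⁻¹ : ℝ) ^ k = 2⁻¹ ^ j * 2⁻¹ ^ (k - j) := by rw [← pow_add, hj']
    rw [Real.rpow_add hx1, Real.rpow_add hx1, Real.rpow_add hx2, Real.rpow_natCast,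
      Real.rpow_natCast, Real.rpow_natCast, h2,
      show (x - 1) / 2 = (-1) * 2⁻¹ * (1 - x) by ring, show (x + 1) / 2 = 2⁻¹ * (1 + x) by ring]
    simp only [mul_pow]
    ring
  have h2 : ∫ x in (-1:ℝ)..1, weight p x * ((poly p k).eval x * (1 - x) ^ m) =
      ∫ x in (-1:ℝ)..1, ∑ j ∈ Finset.range (k + 1),
        (2⁻¹ ^ k * (-1) ^ j * (Ring.choose ((k : ℝ) + A) (k - j) *
        Ring.choose ((k : ℝ) + B) j)) *
          ((1 - x) ^ (A + j + m) * (1 + x) ^ (B + (k - j : ℕ))) := by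
    rw [intervalIntegral.integral_of_le (by norm_num), intervalIntegral.integral_of_le (by norm_num),
      integral_Ioc_eq_integral_Ioo, integral_Ioc_eq_integral_Ioo]
    exact setIntegral_congr_fun measurableSet_Ioo h1
  rw [h2, intervalIntegral.integral_finsetSum fun j hj => (hI j hj).1.const_mul _]
  set q : ℝ[X] := (ascPochhammer ℝ m).comp (X + C (A + 1)) with hq
  have hqd : q.natDegree < k := by
    rw [hq, natDegree_comp, natDegree_X_add_C, mul_one, ascPochhammer_natDegree]
    exact hm
  have h3 := alternating_sum_eq_zero hqd
  rw [← mul_zero (2⁻¹ ^ k * 2 ^ (A + B + m + k + 1) * Real.Gamma (k + A + 1) *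
    Real.Gamma (k + B + 1) / Real.Gamma (A + B + m + k + 2) / k.factorial), ← h3, Finset.mul_sum]
  refine Finset.sum_congr rfl fun j hj => ?_
  have hjk : j ≤ k := by have := Finset.mem_range.1 hj; omega
  rw [intervalIntegral.integral_const_mul, (hI j hj).2]
  have hj' : ((k - j : ℕ) : ℝ) = k - j := Nat.cast_sub hjk
  have e1 := choose_mul_Gamma (r := k + A) (k := k) (n := k - j) (by linarith) (by omega)
  have e2 := choose_mul_Gamma (r := k + B) (k := k) (n := j) (by linarith) hjk
  have e3 := ascPochhammer_Gamma (s := A + j + 1)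
    (by have : (0:ℝ) ≤ (j:ℝ) := by positivity
        linarith) m
  rw [show (k : ℝ) + A - (k - j : ℕ) + 1 = A + j + 1 by rw [hj']; ring] at e1
  rw [show (k : ℝ) + B - j + 1 = B + (k - j : ℕ) + 1 by rw [hj']; ring] at e2
  rw [show A + j + 1 + m = A + j + m + 1 by ring] at e3
  have e4 : q.eval (j : ℝ) = (ascPochhammer ℝ m).eval (A + j + 1) := by
    rw [hq, eval_comp]; simp only [eval_add, eval_X, eval_C]; congr 1; ring
  have e5 : (k.choose j : ℝ) / k.factorial = 1 / (k - j).factorial / j.factorial := by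
    rw [Nat.cast_choose ℝ hjk]
    have := Nat.factorial_ne_zero k
    field_simp
  rw [e3, e4]
  generalize (2:ℝ) ^ (A + B + m + k + 1) = t1 at *
  generalize Real.Gamma (A + B + m + k + 2) = t2 at *
  calc _ = 2⁻¹ ^ k * (-1) ^ j * t1 / t2 * (ascPochhammer ℝ m).eval (A + j + 1) *
        (Ring.choose (k + A) (k - j) * Real.Gamma (A + j + 1)) *
        (Ring.choose (k + B) j * Real.Gamma (B + (k - j : ℕ) + 1)) := by ring
    _ = 2⁻¹ ^ k * (-1) ^ j * t1 / t2 * (ascPochhammer ℝ m).eval (A + j + 1) *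
        Real.Gamma (k + A + 1) * Real.Gamma (k + B + 1) *
        (1 / (k - j).factorial / j.factorial) := by rw [e1, e2]; ring
    _ = _ := by rw [← e5]; ring

lemma integral_poly_mul (p : Param) {k : ℕ} {q : ℝ[X]} (hq : q.degree < k) :
    ∫ x, (poly p k).eval x * q.eval x ∂measure p = 0 := by
  let φ : ℝ[X] →ₗ[ℝ] ℝ :=
    { toFun := fun q => ∫ x, (poly p k).eval x * q.eval x ∂measure p
      map_add' := fun q r => by
        simp only [eval_add, mul_add]
        exact integral_add (integrable_measure p (by fun_prop)) (integrable_measure p (by fun_prop))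
      map_smul' := fun c q => by
        simp only [eval_smul, smul_eq_mul, RingHom.id_apply]
        rw [← integral_const_mul]
        congr 1; ext x; ring }
  refine map_eq_zero_of_degree_lt k q hq φ fun m hm => ?_
  have := integral_poly_mul_pow p hm
  simpa [φ] using this

lemma integral_poly_mul_poly (p : Param) {k l : ℕ} (h : k ≠ l) :
    ∫ x, (poly p k).eval x * (poly p l).eval x ∂measure p = 0 := by
  rcases lt_or_gt_of_ne h with h | h
  · simp_rw [mul_comm ((poly p k).eval _)]
    exact integral_poly_mul p (by rw [poly_degree]; exact_mod_cast h)
  · exact integral_poly_mul p (by rw [poly_degree]; exact_mod_cast h)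

/-! ### The differential equation of the Jacobi polynomials -/

lemma ode_term (α β : ℝ) (U V : ℝ[X]) (hU : derivative U = C 2⁻¹) (hV : derivative V = C 2⁻¹)
    (j l : ℕ) :
    4 * (U * V * derivative (derivative (U ^ j * V ^ l))) +
      2 * ((C (α + 1) * V + C (β + 1) * U) * derivative (U ^ j * V ^ l)) =
    C (j * (j + α)) * (U ^ (j - 1) * V ^ (l + 1)) + C (l * (l + β)) * (U ^ (j + 1) * V ^ (l - 1)) +
      C (2 * j * l + (α + 1) * l + (β + 1) * j) * (U ^ j * V ^ l) := by
  have key : ∀ (U : ℝ[X]), derivative U = C 2⁻¹ → ∀ j : ℕ,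
      2 * derivative (U ^ j) = C (j : ℝ) * U ^ (j - 1) ∧
      4 * (U * derivative (derivative (U ^ j))) = C ((j : ℝ) * (j - 1)) * U ^ (j - 1) ∧
      C (j : ℝ) * (U * U ^ (j - 1)) = C (j : ℝ) * U ^ j := by
    intro U hU j
    have h2 : (2 : ℝ[X]) * C 2⁻¹ = 1 := by
      rw [show (2 : ℝ[X]) = C 2 from rfl, ← C_mul]; norm_num
    have h4 : (4 : ℝ[X]) * (C 2⁻¹ * C 2⁻¹) = 1 := by
      rw [show (4 : ℝ[X]) = C 4 from rfl, ← C_mul, ← C_mul]; norm_num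
    rcases j with _ | _ | j
    · simp
    · simp [hU, h2]
    · refine ⟨?_, ?_, ?_⟩
      · simp only [derivative_pow, hU, Nat.add_sub_cancel]
        linear_combination (C ((j + 2 : ℕ) : ℝ) * U ^ (j + 1)) * h2
      · simp only [derivative_pow, derivative_mul, derivative_C, hU, Nat.add_sub_cancel]
        push_cast
        simp only [C_mul, C_add, C_sub, C_1, map_natCast, zero_mul, mul_zero, add_zero, zero_add]
        linear_combination ((j + 1 + 1) * (j + 1) * U ^ (j + 1) : ℝ[X]) * h4
      · simp only [Nat.add_sub_cancel]; ring
  obtain ⟨u1, u2, u3⟩ := key U hU j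
  obtain ⟨v1, v2, v3⟩ := key V hV l
  have e : derivative (derivative (U ^ j * V ^ l)) = derivative (derivative (U ^ j)) * V ^ l +
      2 * (derivative (U ^ j) * derivative (V ^ l)) + U ^ j * derivative (derivative (V ^ l)) := by
    simp only [derivative_mul, derivative_add]; ring
  rw [e, derivative_mul]
  simp only [C_mul, C_add, C_sub, C_1, pow_succ, map_natCast] at *
  rw [show (C 2 : ℝ[X]) = 2 from rfl]
  linear_combination (V * V ^ l) * u2 + (U * U ^ j) * v2 +
    (2 * U * V * (2 * derivative (V ^ l)) + (C α + 1) * V * V ^ l + (C β + 1) * U * V ^ l) * u1 +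
    (2 * U * V * (j * U ^ (j - 1)) + (C α + 1) * V * U ^ j + (C β + 1) * U * U ^ j) * v1 +
    (2 * V * (l * V ^ (l - 1)) + (C β + 1) * V ^ l) * u3 +
    (2 * (j * U ^ j) + (C α + 1) * U ^ j) * v3

lemma choose_step {r : ℝ} (n : ℕ) :
    Ring.choose r (n + 1) * (n + 1) = Ring.choose r n * (r - n) := by
  rw [choose_eq_prod, choose_eq_prod, Finset.prod_range_succ, Nat.factorial_succ]
  have := Nat.factorial_ne_zero n
  push_cast
  field_simp

/-- The Jacobi differential equation
`(1 - x²) P_k'' + (β - α - (α + β + 2) x) P_k' + k (k + α + β + 1) P_k = 0`. -/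
theorem poly_ode (p : Param) (k : ℕ) :
    (1 - X ^ 2) * derivative (derivative (poly p k)) +
      (C (p.β - p.α) - C (p.α + p.β + 2) * X) * derivative (poly p k) +
      C ((k : ℝ) * (k + 2 * p.a)) * poly p k = 0 := by
  set U : ℝ[X] := C 2⁻¹ * (X - 1) with hUdef
  set V : ℝ[X] := C 2⁻¹ * (X + 1) with hVdef
  have hU : derivative U = C 2⁻¹ := by simp [hUdef]
  have hV : derivative V = C 2⁻¹ := by simp [hVdef]
  have h2 : (2 : ℝ[X]) * C 2⁻¹ = 1 := by
    rw [show (2 : ℝ[X]) = C 2 from rfl, ← C_mul]; norm_num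
  have hX : (X : ℝ[X]) = U + V := by rw [hUdef, hVdef]; linear_combination (-X) * h2
  have h1 : (1 : ℝ[X]) = V - U := by rw [hUdef, hVdef]; linear_combination (-1) * h2
  let c : ℕ → ℝ := fun j => Ring.choose ((k : ℝ) + p.α) (k - j) * Ring.choose ((k : ℝ) + p.β) j
  have hP : poly p k = ∑ j ∈ Finset.range (k + 1), C (c j) * (U ^ j * V ^ (k - j)) := rfl
  have e1 : (1 - X ^ 2 : ℝ[X]) = - (4 * (U * V)) := by
    rw [hX]; linear_combination (1 + V - U) * h1
  have e2 : (C (p.β - p.α) - C (p.α + p.β + 2) * X : ℝ[X]) =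
      - (2 * (C (p.α + 1) * V + C (p.β + 1) * U)) := by
    rw [hX]
    simp only [C_add, C_sub, C_1]
    rw [show (C 2 : ℝ[X]) = 2 from rfl]
    linear_combination (C p.β - C p.α) * h1
  rw [e1, e2]
  suffices h : ∑ j ∈ Finset.range (k + 1), C (c j) *
      (4 * (U * V * derivative (derivative (U ^ j * V ^ (k - j)))) +
      2 * ((C (p.α + 1) * V + C (p.β + 1) * U) * derivative (U ^ j * V ^ (k - j)))) =
      C ((k : ℝ) * (k + 2 * p.a)) * poly p k by
    rw [← h, hP]
    simp only [derivative_sum, derivative_C_mul, Finset.mul_sum, ← Finset.sum_add_distrib]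
    exact Finset.sum_eq_zero fun j _ => by ring
  simp only [ode_term p.α p.β U V hU hV, mul_add (C (c _)), Finset.sum_add_distrib]
  have A : ∑ j ∈ Finset.range (k + 1), C (c j) * (C ((j : ℝ) * (j + p.α)) *
        (U ^ (j - 1) * V ^ (k - j + 1))) =
      ∑ j ∈ Finset.range (k + 1), C (c j) * (C (((k : ℝ) - j) * (k + p.β - j)) *
        (U ^ j * V ^ (k - j))) := by
    rw [Finset.sum_range_succ', Finset.sum_range_succ _ k]
    simp only [Nat.cast_zero, zero_mul, C_0, mul_zero, add_zero, sub_self]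
    refine Finset.sum_congr rfl fun j hj => ?_
    have hj := Finset.mem_range.1 hj
    have hk : k - j = k - (j + 1) + 1 := by omega
    rw [Nat.add_sub_cancel, ← hk, ← mul_assoc, ← C_mul, ← mul_assoc (C (c j)), ← C_mul]
    congr 2
    simp only [c]
    have s1 := choose_step (r := (k : ℝ) + p.α) (k - (j + 1))
    have s2 := choose_step (r := (k : ℝ) + p.β) j
    rw [← hk] at s1
    rw [Nat.cast_sub (by omega)] at s1
    push_cast at s1 ⊢
    linear_combination (Ring.choose ((k : ℝ) + p.α) (k - (j + 1)) * (j + 1 + p.α)) * s2 -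
      (Ring.choose ((k : ℝ) + p.β) j * (k + p.β - j)) * s1
  have B : ∑ j ∈ Finset.range (k + 1), C (c j) * (C (((k - j : ℕ) : ℝ) * ((k - j : ℕ) + p.β)) *
        (U ^ (j + 1) * V ^ (k - j - 1))) =
      ∑ j ∈ Finset.range (k + 1), C (c j) * (C ((j : ℝ) * (j + p.α)) *
        (U ^ j * V ^ (k - j))) := by
    rw [Finset.sum_range_succ, Finset.sum_range_succ' _ k]
    simp only [Nat.cast_zero, zero_mul, C_0, mul_zero, add_zero, Nat.sub_self]
    refine Finset.sum_congr rfl fun j hj => ?_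
    have hj := Finset.mem_range.1 hj
    have hk : k - j = k - (j + 1) + 1 := by omega
    rw [Nat.sub_sub, ← mul_assoc, ← C_mul, ← mul_assoc (C (c (j + 1))), ← C_mul]
    congr 2
    simp only [c]
    have s1 := choose_step (r := (k : ℝ) + p.α) (k - (j + 1))
    have s2 := choose_step (r := (k : ℝ) + p.β) j
    rw [← hk] at s1
    rw [Nat.cast_sub (by omega)] at s1
    rw [Nat.cast_sub (by omega)]
    push_cast at s1 ⊢
    linear_combination (Ring.choose ((k : ℝ) + p.β) j * (k - j + p.β)) * s1 -
      (Ring.choose ((k : ℝ) + p.α) (k - (j + 1)) * (j + 1 + p.α)) * s2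
  rw [A, B, hP, Finset.mul_sum, ← Finset.sum_add_distrib, ← Finset.sum_add_distrib]
  refine Finset.sum_congr rfl fun j hj => ?_
  have hj := Finset.mem_range.1 hj
  have : (C (((k : ℝ) - j) * (k + p.β - j)) + C ((j : ℝ) * (j + p.α)) +
      C (2 * (j : ℝ) * ((k - j : ℕ) : ℝ) + (p.α + 1) * ((k - j : ℕ) : ℝ) + (p.β + 1) * j) : ℝ[X]) =
      C ((k : ℝ) * (k + 2 * p.a)) := by
    rw [← C_add, ← C_add, Nat.cast_sub (by omega), Param.a]
    congr 1; ring
  rw [← this]; ring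

/-- `ℒ P_k = k (k + 2a) P_k` on `(-1, 1)` for `ℒ = - w⁻¹ d/dx ((1 - x²) w d/dx)`. -/
theorem poly_eigen (p : Param) (k : ℕ) {x : ℝ} (hx : x ∈ Set.Ioo (-1 : ℝ) 1) :
    -(weight p x)⁻¹ * deriv (fun y => (1 - y ^ 2) * weight p y *
      deriv (fun z => (poly p k).eval z) y) x = k * (k + 2 * p.a) * (poly p k).eval x := by
  have hx1 : 0 < 1 - x := by linarith [hx.2]
  have hx2 : 0 < 1 + x := by linarith [hx.1]
  have hw : HasDerivAt (weight p)
      (weight p x * (-p.α / (1 - x) + p.β / (1 + x))) x := by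
    have a1 : HasDerivAt (fun y : ℝ => (1 - y) ^ p.α) (-1 * p.α * (1 - x) ^ (p.α - 1)) x :=
      ((hasDerivAt_id x).const_sub 1).rpow_const (Or.inl hx1.ne')
    have a2 : HasDerivAt (fun y : ℝ => (1 + y) ^ p.β) (1 * p.β * (1 + x) ^ (p.β - 1)) x :=
      ((hasDerivAt_id x).const_add 1).rpow_const (Or.inl hx2.ne')
    have a3 : HasDerivAt (weight p) _ x := a1.mul a2
    refine a3.congr_deriv ?_
    rw [weight, Real.rpow_sub_one hx1.ne', Real.rpow_sub_one hx2.ne']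
    field_simp
  have hw0 : weight p x ≠ 0 := (mul_pos (Real.rpow_pos_of_pos hx1 _) (Real.rpow_pos_of_pos hx2 _)).ne'
  have hd : (fun y => (1 - y ^ 2) * weight p y * deriv (fun z => (poly p k).eval z) y) =
      fun y => (1 - y ^ 2) * weight p y * (derivative (poly p k)).eval y := by
    ext y; rw [Polynomial.deriv]
  have h1 : HasDerivAt (fun y : ℝ => 1 - y ^ 2) (-(2 * x)) x := by
    have := ((hasDerivAt_id x).pow 2).const_sub 1
    simpa using this
  have h2 : HasDerivAt (fun y => (1 - y ^ 2) * weight p y * (derivative (poly p k)).eval y) _ x :=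
    (h1.mul hw).mul ((derivative (poly p k)).hasDerivAt x)
  rw [hd, HasDerivAt.deriv h2]
  have ode := congrArg (eval x) (poly_ode p k)
  simp only [eval_add, eval_mul, eval_sub, eval_C, eval_X, eval_pow, eval_one, eval_zero] at ode
  simp only [Pi.mul_apply]
  field_simp
  linear_combination (-1 : ℝ) * (1 - x) * (1 + x) * ode

/-! ### Completeness of the Jacobi polynomials -/

section Support

variable {Z : Type*} [MetricSpace Z] [MeasurableSpace Z] [BorelSpace Z]
  {ν : Measure Z} [IsFiniteMeasure ν] {K : Set Z}

lemma memLp_of_continuous (hK : IsCompact K) (hν : ∀ᵐ x ∂ν, x ∈ K) {f : Z → ℝ}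
    (hf : Continuous f) (q : ℝ≥0∞) : MemLp f q ν := by
  obtain ⟨c, hc⟩ := hK.exists_bound_of_continuousOn hf.continuousOn
  refine MemLp.of_bound hf.aestronglyMeasurable c ?_
  filter_upwards [hν] with x hx using hc x hx

lemma eq_zero_of_orthogonal [SecondCountableTopology Z] (hK : IsCompact K) (hν : ∀ᵐ x ∂ν, x ∈ K) (A : Subalgebra ℝ C(Z, ℝ))
    (hA : A.SeparatesPoints) (f : Lp ℝ 2 ν) (h : ∀ g ∈ A, ∫ x, f x * g x ∂ν = 0) : f = 0 := by
  have hC : ∀ ε > 0, ‖f‖ ≤ ε + ((measureUnivNNReal ν : ℝ) ^ ((2 : ℝ≥0∞).toReal⁻¹)) * ε := by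
    intro ε hε
    obtain ⟨u, hu⟩ := (BoundedContinuousFunction.toLp_denseRange ℝ ν ℝ
      (p := 2) (by norm_num)).exists_dist_lt f hε
    obtain ⟨g, hgA, hg⟩ :=
      ContinuousMap.exists_mem_subalgebra_near_continuous_of_isCompact_of_separatesPoints hA
        u.toContinuousMap hK hε
    have hgm := memLp_of_continuous hK hν g.continuous 2
    set G : Lp ℝ 2 ν := hgm.toLp
    have h0 : inner ℝ f G = 0 := by
      rw [L2.inner_def, ← h g hgA]
      refine integral_congr_ae ?_
      filter_upwards [hgm.coeFn_toLp] with x hx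
      rw [real_inner_eq_re_inner, hx]
      simp [mul_comm]
    have h1 : ‖f‖ * ‖f‖ ≤ ‖f‖ * ‖f - G‖ := by
      rw [← real_inner_self_eq_norm_mul_norm]
      calc inner ℝ f f = inner ℝ f (f - G) := by rw [inner_sub_right, h0, sub_zero]
        _ ≤ _ := real_inner_le_norm _ _
    have h2 : ‖f‖ ≤ ‖f - G‖ := by
      rcases (norm_nonneg f).eq_or_lt with h | h
      · rw [← h]; positivity
      · exact le_of_mul_le_mul_left h1 h
    have h3 : ‖BoundedContinuousFunction.toLp 2 ν ℝ u - G‖ ≤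
        (measureUnivNNReal ν : ℝ) ^ ((2 : ℝ≥0∞).toReal⁻¹) * ε := by
      refine Lp.norm_le_of_ae_bound hε.le ?_
      filter_upwards [hν, hgm.coeFn_toLp, BoundedContinuousFunction.coeFn_toLp (p := 2) ν ℝ u,
        Lp.coeFn_sub (BoundedContinuousFunction.toLp 2 ν ℝ u) G] with x h1 h2 h3 h4
      rw [h4, Pi.sub_apply, h2, h3, norm_sub_rev]
      exact (hg x h1).le
    calc ‖f‖ ≤ ‖f - G‖ := h2
      _ ≤ ‖f - BoundedContinuousFunction.toLp 2 ν ℝ u‖ +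
          ‖BoundedContinuousFunction.toLp 2 ν ℝ u - G‖ := norm_sub_le_norm_sub_add_norm_sub _ _ _
      _ ≤ _ := add_le_add (by rw [← dist_eq_norm]; exact hu.le) h3
  have : ‖f‖ ≤ 0 := by
    refine le_of_forall_pos_le_add fun ε hε => ?_
    set c : ℝ := (measureUnivNNReal ν : ℝ) ^ ((2 : ℝ≥0∞).toReal⁻¹)
    have hc : 0 ≤ c := by positivity
    have := hC (ε / (1 + c)) (by positivity)
    calc ‖f‖ ≤ _ := this
      _ = 0 + ε := by field_simp; ring
  exact norm_le_zero_iff.1 this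

end Support

lemma measure_ne_zero (p : Param) : measure p ≠ 0 := by
  intro h
  have h1 := integral_measure p (fun _ => 1)
  simp only [h, integral_zero_measure, mul_one, weight] at h1
  rw [(beta_interval p.hα p.hβ).2] at h1
  have hα := p.hα
  have hβ := p.hβ
  have := Real.Gamma_pos_of_pos (show 0 < p.α + 1 by linarith)
  have := Real.Gamma_pos_of_pos (show 0 < p.β + 1 by linarith)
  have := Real.Gamma_pos_of_pos (show 0 < p.α + p.β + 2 by linarith)
  exact absurd h1 (by positivity)

lemma polyNorm_sq_pos (p : Param) (k : ℕ) : 0 < ∫ x, (poly p k).eval x ^ 2 ∂measure p := by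
  refine lt_of_le_of_ne (integral_nonneg fun x => sq_nonneg _) fun h => measure_ne_zero p ?_
  rw [eq_comm, integral_eq_zero_iff_of_nonneg (fun x => sq_nonneg _)
    (integrable_measure p ((poly p k).continuous.pow 2))] at h
  have hfin : (measure p) {x | (poly p k).IsRoot x} = 0 := by
    refine (withDensity_absolutelyContinuous _ _).trans Measure.restrict_le_self.absolutelyContinuous ?_
    exact (Polynomial.finite_setOfPred_isRoot (poly_ne_zero p k)).measure_zero _
  rw [← Measure.measure_univ_eq_zero]
  have h2 : ∀ᵐ x ∂measure p, False := by
    filter_upwards [h, measure_eq_zero_iff_ae_notMem.1 hfin] with x h1 h2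
    exact h2 (by simpa using h1)
  simpa using h2

lemma basisFun_continuous (p : Param) (k : ℕ) : Continuous (basisFun p k) := by
  unfold basisFun; fun_prop

lemma integral_basisFun_mul (p : Param) (k l : ℕ) :
    ∫ x, basisFun p k x * basisFun p l x ∂measure p = if k = l then 1 else 0 := by
  have : ∀ x, basisFun p k x * basisFun p l x = (polyNorm p k)⁻¹ * (polyNorm p l)⁻¹ *
      ((poly p k).eval x * (poly p l).eval x) := fun x => by unfold basisFun; ring
  simp_rw [this]
  rw [integral_const_mul]
  split_ifs with h
  · subst h
    have h1 := polyNorm_sq_pos p k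
    simp_rw [← sq]
    rw [polyNorm, inv_pow, Real.sq_sqrt h1.le, inv_mul_cancel₀ h1.ne']
  · rw [integral_poly_mul_poly p h, mul_zero]

lemma poly_mem_span_basisFun (p : Param) (q : ℝ[X]) :
    ∃ c : ℕ →₀ ℝ, ∀ x, q.eval x = ∑ k ∈ c.support, c k * basisFun p k x := by
  have hq : q ∈ Submodule.span ℝ (Set.range (poly p)) := by rw [span_poly]; trivial
  obtain ⟨c, rfl⟩ := (Finsupp.mem_span_range_iff_exists_finsupp).1 hq
  have hN : ∀ k, polyNorm p k ≠ 0 := fun k => (Real.sqrt_pos.2 (polyNorm_sq_pos p k)).ne'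
  refine ⟨Finsupp.onFinset c.support (fun k => c k * polyNorm p k) fun k hk => ?_, fun x => ?_⟩
  · exact Finsupp.mem_support_iff.2 (left_ne_zero_of_mul hk)
  · have hs : (Finsupp.onFinset c.support (fun k => c k * polyNorm p k) fun k hk =>
        Finsupp.mem_support_iff.2 (left_ne_zero_of_mul hk)).support = c.support := by
      ext k; simp [hN k]
    rw [hs, Finsupp.sum, eval_finsetSum]
    refine Finset.sum_congr rfl fun k _ => ?_
    have := hN k
    simp only [eval_smul, smul_eq_mul, Finsupp.onFinset_apply, basisFun]
    field_simp

lemma measure_memLp (p : Param) {f : ℝ → ℝ} (hf : Continuous f) : MemLp f 2 (measure p) :=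
  memLp_of_continuous isCompact_Icc (measure_ae_mem p) hf 2

/-- The normalized Jacobi polynomial as an element of `L_2([-1, 1], w)`. -/
def basisVec (p : Param) (k : ℕ) : Lp ℝ 2 (measure p) :=
  (measure_memLp p (basisFun_continuous p k)).toLp

lemma inner_basisVec (p : Param) (k : ℕ) (f : Lp ℝ 2 (measure p)) :
    inner ℝ (basisVec p k) f = ∫ x, f x * basisFun p k x ∂measure p := by
  rw [L2.inner_def]
  refine integral_congr_ae ?_
  filter_upwards [(measure_memLp p (basisFun_continuous p k)).coeFn_toLp] with x hx
  rw [basisVec, hx]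
  simp

lemma orthonormal_basisVec (p : Param) : Orthonormal ℝ (basisVec p) := by
  rw [orthonormal_iff_ite]
  intro k l
  rw [inner_basisVec, ← integral_basisFun_mul]
  refine integral_congr_ae ?_
  filter_upwards [(measure_memLp p (basisFun_continuous p l)).coeFn_toLp] with x hx
  rw [basisVec, hx, mul_comm]

lemma basisVec_orthogonal_eq_bot (p : Param) :
    (Submodule.span ℝ (Set.range (basisVec p)))ᗮ = ⊥ := by
  rw [Submodule.eq_bot_iff]
  intro f hf
  have h0 : ∀ k, ∫ x, f x * basisFun p k x ∂measure p = 0 := fun k => by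
    rw [← inner_basisVec]
    exact hf _ (Submodule.subset_span ⟨k, rfl⟩)
  have hint : ∀ k, Integrable (fun x => f x * basisFun p k x) (measure p) := fun k =>
    (Lp.memLp f).integrable_mul (measure_memLp p (basisFun_continuous p k))
  refine eq_zero_of_orthogonal isCompact_Icc (measure_ae_mem p)
    (Polynomial.toContinuousMapAlgHom (R := ℝ)).range ?_ f ?_
  · intro x y hxy
    refine ⟨_, ⟨_, ⟨X, rfl⟩, rfl⟩, ?_⟩
    change eval x (X : ℝ[X]) ≠ eval y X
    simpa using hxy
  · rintro _ ⟨q, rfl⟩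
    obtain ⟨c, hc⟩ := poly_mem_span_basisFun p q
    change ∫ x, f x * q.eval x ∂measure p = 0
    have : ∀ x, f x * q.eval x = ∑ k ∈ c.support, c k * (f x * basisFun p k x) := fun x => by
      rw [hc, Finset.mul_sum]
      exact Finset.sum_congr rfl fun k _ => by ring
    simp_rw [this]
    rw [integral_finsetSum _ fun k _ => (hint k).const_mul _]
    exact Finset.sum_eq_zero fun k _ => by rw [integral_const_mul, h0, mul_zero]

/-- The orthonormal basis of `L_2([-1, 1], w)` of normalized Jacobi polynomials. -/
def basis (p : Param) : HilbertBasis ℕ ℝ (Lp ℝ 2 (measure p)) :=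
  HilbertBasis.mkOfOrthogonalEqBot (orthonormal_basisVec p) (basisVec_orthogonal_eq_bot p)

/-! ### The cube -/

lemma isCompact_cube (d : ℕ) : IsCompact (cube d) := isCompact_univ_pi fun _ => isCompact_Icc

lemma cubeMeasure_ae_mem (p : Param) (d : ℕ) : ∀ᵐ x ∂cubeMeasure p d, x ∈ cube d :=
  withDensity_absolutelyContinuous _ _
    (by simp [Measure.restrict_apply' (isCompact_cube d).measurableSet])

/-- The measure `w_d(x) dx` is the product of the measures `w(x_j) dx_j`. -/
theorem cubeMeasure_eq_pi (p : Param) (d : ℕ) :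
    cubeMeasure p d = Measure.pi fun _ => measure p := by
  symm
  refine Measure.pi_eq fun s hs => ?_
  have hcube : (volume : Measure (Fin d → ℝ)).restrict (cube d) =
      Measure.pi fun _ => volume.restrict (Set.Icc (-1) 1) := by
    rw [cube, volume_pi, Measure.restrict_pi_pi]
  have hint : Integrable (fun x : Fin d → ℝ => ∏ j, (s j).indicator (weight p) (x j))
      (Measure.pi fun _ => volume.restrict (Set.Icc (-1) 1)) :=
    Integrable.fintype_prod fun j =>
      Integrable.indicator (integrableOn_weight p) (hs j)
  have hnn : ∀ j, ∀ x ∈ Set.Icc (-1 : ℝ) 1, 0 ≤ (s j).indicator (weight p) x := fun j x hx =>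
    Set.indicator_apply_nonneg fun _ => weight_nonneg p hx
  have h1 : ∀ j, measure p (s j) =
      ENNReal.ofReal (∫ x in Set.Icc (-1) 1, (s j).indicator (weight p) x) := fun j => by
    rw [measure, withDensity_apply _ (hs j), ofReal_integral_eq_lintegral_ofReal
      (Integrable.indicator (integrableOn_weight p) (hs j))
      (ae_restrict_of_forall_mem measurableSet_Icc (hnn j)), ← lintegral_indicator (hs j)]
    congr 1; ext x
    by_cases hx : x ∈ s j <;> simp [hx]
  rw [cubeMeasure, withDensity_apply _ (MeasurableSet.univ_pi hs),
    ← lintegral_indicator (MeasurableSet.univ_pi hs)]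
  have h2 : ∀ x : Fin d → ℝ, (Set.univ.pi s).indicator
      (fun x => ENNReal.ofReal (∏ j, weight p (x j))) x =
      ENNReal.ofReal (∏ j, (s j).indicator (weight p) (x j)) := fun x => by
    by_cases hx : x ∈ Set.univ.pi s
    · rw [Set.indicator_of_mem hx]
      congr 1
      exact Finset.prod_congr rfl fun j _ => by rw [Set.indicator_of_mem (hx j trivial)]
    · rw [Set.indicator_of_notMem hx]
      obtain ⟨j, hj⟩ : ∃ j, x j ∉ s j := by simpa using hx
      rw [Finset.prod_eq_zero (Finset.mem_univ j) (Set.indicator_of_notMem hj _),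
        ENNReal.ofReal_zero]
  simp_rw [h2, h1]
  rw [← ofReal_integral_eq_lintegral_ofReal (by rw [hcube]; exact hint), hcube,
    integral_fintype_prod_eq_prod, ENNReal.ofReal_prod_of_nonneg]
  · exact fun j _ => setIntegral_nonneg measurableSet_Icc (hnn j)
  · refine ae_restrict_of_forall_mem (isCompact_cube d).measurableSet fun x hx => ?_
    exact Finset.prod_nonneg fun j _ => hnn j _ (hx j trivial)

instance (p : Param) (d : ℕ) : IsFiniteMeasure (cubeMeasure p d) := by
  rw [cubeMeasure_eq_pi]; infer_instance

lemma cubeMeasure_memLp (p : Param) {d : ℕ} {f : (Fin d → ℝ) → ℝ} (hf : Continuous f) :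
    MemLp f 2 (cubeMeasure p d) :=
  memLp_of_continuous (isCompact_cube d) (cubeMeasure_ae_mem p d) hf 2

/-- The tensor product `p_{k_1} ⊗ ⋯ ⊗ p_{k_d}` of normalized Jacobi polynomials. -/
def cubeBasisFun (p : Param) (d : ℕ) (k : Fin d → ℕ) (x : Fin d → ℝ) : ℝ :=
  ∏ j, basisFun p (k j) (x j)

lemma cubeBasisFun_continuous (p : Param) (d : ℕ) (k : Fin d → ℕ) :
    Continuous (cubeBasisFun p d k) := by
  unfold cubeBasisFun
  exact continuous_finsetProd _ fun j _ =>
    (basisFun_continuous p (k j)).comp (continuous_apply j)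

/-- `p_{k_1} ⊗ ⋯ ⊗ p_{k_d}` as an element of `L_2([-1, 1] ^ d, w_d)`. -/
def cubeBasisVec (p : Param) (d : ℕ) (k : Fin d → ℕ) : Lp ℝ 2 (cubeMeasure p d) :=
  (cubeMeasure_memLp p (cubeBasisFun_continuous p d k)).toLp

lemma inner_cubeBasisVec (p : Param) (d : ℕ) (k : Fin d → ℕ) (f : Lp ℝ 2 (cubeMeasure p d)) :
    inner ℝ (cubeBasisVec p d k) f = ∫ x, f x * cubeBasisFun p d k x ∂cubeMeasure p d := by
  rw [L2.inner_def]
  refine integral_congr_ae ?_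
  filter_upwards [(cubeMeasure_memLp p (cubeBasisFun_continuous p d k)).coeFn_toLp] with x hx
  rw [cubeBasisVec, hx]
  simp

lemma orthonormal_cubeBasisVec (p : Param) (d : ℕ) : Orthonormal ℝ (cubeBasisVec p d) := by
  rw [orthonormal_iff_ite]
  intro k l
  rw [inner_cubeBasisVec]
  have h1 : ∫ x, cubeBasisVec p d l x * cubeBasisFun p d k x ∂cubeMeasure p d =
      ∫ x, ∏ j, (basisFun p (l j) (x j) * basisFun p (k j) (x j)) ∂cubeMeasure p d := by
    refine integral_congr_ae ?_
    filter_upwards [(cubeMeasure_memLp p (cubeBasisFun_continuous p d l)).coeFn_toLp] with x hx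
    rw [cubeBasisVec, hx, Finset.prod_mul_distrib]
    rfl
  rw [h1, cubeMeasure_eq_pi, integral_fintype_prod_eq_prod
    (f := fun j x => basisFun p (l j) x * basisFun p (k j) x)]
  simp_rw [integral_basisFun_mul]
  split_ifs with h
  · subst h; simp
  · obtain ⟨j, hj⟩ := Function.ne_iff.1 h
    exact Finset.prod_eq_zero (Finset.mem_univ j) (if_neg (Ne.symm hj))

lemma cubeBasisVec_orthogonal_eq_bot (p : Param) (d : ℕ) :
    (Submodule.span ℝ (Set.range (cubeBasisVec p d)))ᗮ = ⊥ := by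
  rw [Submodule.eq_bot_iff]
  intro f hf
  have h0 : ∀ k, ∫ x, f x * cubeBasisFun p d k x ∂cubeMeasure p d = 0 := fun k => by
    rw [← inner_cubeBasisVec]
    exact hf _ (Submodule.subset_span ⟨k, rfl⟩)
  have hf2 : ∀ g : (Fin d → ℝ) → ℝ, Continuous g →
      Integrable (fun x => f x * g x) (cubeMeasure p d) := fun g hg =>
    (Lp.memLp f).integrable_mul (cubeMeasure_memLp p hg)
  let ev : Fin d → C(Fin d → ℝ, ℝ) := fun j => ⟨fun x => x j, continuous_apply j⟩
  refine eq_zero_of_orthogonal (isCompact_cube d) (cubeMeasure_ae_mem p d)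
    (MvPolynomial.aeval ev : MvPolynomial (Fin d) ℝ →ₐ[ℝ] _).range ?_ f ?_
  · intro x y hxy
    obtain ⟨j, hj⟩ := Function.ne_iff.1 hxy
    exact ⟨_, ⟨_, ⟨MvPolynomial.X j, rfl⟩, rfl⟩, by simpa [ev] using hj⟩
  · rintro _ ⟨q, rfl⟩
    change ∫ x, f x * (MvPolynomial.aeval ev q) x ∂cubeMeasure p d = 0
    induction q using MvPolynomial.induction_on' with
    | add a b ha hb =>
      have : ∀ x, f x * (MvPolynomial.aeval ev (a + b)) x =
          f x * (MvPolynomial.aeval ev a) x + f x * (MvPolynomial.aeval ev b) x := fun x => by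
        rw [map_add, ContinuousMap.add_apply, mul_add]
      simp_rw [this]
      rw [integral_add (hf2 _ (ContinuousMap.continuous _)) (hf2 _ (ContinuousMap.continuous _)),
        ha, hb, add_zero]
    | monomial u a =>
      have hmon : ∀ x : Fin d → ℝ, (MvPolynomial.aeval ev (MvPolynomial.monomial u a)) x =
          a * ∏ j, ((X : ℝ[X]) ^ u j).eval (x j) := fun x => by
        rw [MvPolynomial.aeval_monomial, Finsupp.prod_fintype _ _ (by simp)]
        simp [ev, ContinuousMap.prod_apply]
      choose c hc using fun j => poly_mem_span_basisFun p ((X : ℝ[X]) ^ u j)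
      have : ∀ x : Fin d → ℝ, f x * (MvPolynomial.aeval ev (MvPolynomial.monomial u a)) x =
          ∑ k ∈ Fintype.piFinset fun j => (c j).support,
            (a * ∏ j, c j (k j)) * (f x * cubeBasisFun p d k x) := fun x => by
        rw [hmon]
        simp_rw [hc]
        rw [Finset.prod_univ_sum, Finset.mul_sum, Finset.mul_sum]
        refine Finset.sum_congr rfl fun k _ => ?_
        rw [Finset.prod_mul_distrib, cubeBasisFun]
        ring
      simp_rw [this]
      rw [integral_finsetSum _ fun k _ => (hf2 _ (cubeBasisFun_continuous p d k)).const_mul _]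
      exact Finset.sum_eq_zero fun k _ => by rw [integral_const_mul, h0, mul_zero]

/-- The orthonormal basis of `L_2([-1, 1] ^ d, w_d)` of tensor products of normalized Jacobi
polynomials. -/
def cubeBasis (p : Param) (d : ℕ) : HilbertBasis (Fin d → ℕ) ℝ (Lp ℝ 2 (cubeMeasure p d)) :=
  HilbertBasis.mkOfOrthogonalEqBot (orthonormal_cubeBasisVec p d)
    (cubeBasisVec_orthogonal_eq_bot p d)

/-! ### Hilbert spaces of functions with weighted Fourier coefficients -/

section Weighted

variable {ι E : Type*} [NormedAddCommGroup E] [InnerProductSpace ℝ E]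

lemma summable_weighted_mul {Λ : ι → ℝ} (hΛ : ∀ i, 1 ≤ Λ i) {u v : ι → ℝ}
    (hu : Summable fun i => Λ i * u i ^ 2) (hv : Summable fun i => Λ i * v i ^ 2) :
    Summable fun i => Λ i * (u i * v i) := by
  refine Summable.of_norm_bounded (hu.add hv) fun i => ?_
  have h0 : 0 ≤ Λ i := zero_le_one.trans (hΛ i)
  rw [Real.norm_eq_abs, abs_mul, abs_of_nonneg h0, ← mul_add]
  refine mul_le_mul_of_nonneg_left ?_ h0
  rw [abs_le]
  constructor <;> nlinarith [sq_nonneg (u i + v i), sq_nonneg (u i - v i)]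

/-- The vectors `f` with `∑ i, Λ i * f_i ^ 2 < ∞`, where `f_i` is the `i`-th Fourier coefficient of
`f` with respect to the orthonormal basis `b`. -/
def weightedSubmodule (b : HilbertBasis ι ℝ E) (Λ : ι → ℝ) (hΛ : ∀ i, 1 ≤ Λ i) :
    Submodule ℝ E where
  carrier := {f | Summable fun i => Λ i * inner ℝ (b i) f ^ 2}
  zero_mem' := by simp [summable_zero]
  add_mem' := fun {f g} hf hg => by
    have h := (hf.add hg).add ((summable_weighted_mul hΛ hf hg).mul_left 2)
    refine h.congr fun i => ?_
    rw [inner_add_right]; ring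
  smul_mem' := fun c f hf => by
    refine (Summable.mul_left (c ^ 2) hf).congr fun i => ?_
    rw [inner_smul_right]; ring

/-- The space `weightedSubmodule b Λ hΛ`, with its own scalar product
`⟨f, g⟩ = ∑ i, Λ i * f_i * g_i`. -/
def WeightedSpace (b : HilbertBasis ι ℝ E) (Λ : ι → ℝ) (hΛ : ∀ i, 1 ≤ Λ i) : Type _ :=
  weightedSubmodule b Λ hΛ

variable (b : HilbertBasis ι ℝ E) (Λ : ι → ℝ) (hΛ : ∀ i, 1 ≤ Λ i)

instance : AddCommGroup (WeightedSpace b Λ hΛ) :=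
  inferInstanceAs (AddCommGroup (weightedSubmodule b Λ hΛ))

instance : Module ℝ (WeightedSpace b Λ hΛ) :=
  inferInstanceAs (Module ℝ (weightedSubmodule b Λ hΛ))

/-- The inclusion of the weighted space into the ambient space. -/
def WeightedSpace.incl : WeightedSpace b Λ hΛ →ₗ[ℝ] E := (weightedSubmodule b Λ hΛ).subtype

/-- The `i`-th Fourier coefficient. -/
def WeightedSpace.coeff (i : ι) : WeightedSpace b Λ hΛ →ₗ[ℝ] ℝ :=
  (innerSL ℝ (b i)).toLinearMap ∘ₗ WeightedSpace.incl b Λ hΛ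

variable {b Λ hΛ}

lemma WeightedSpace.incl_injective : Function.Injective (WeightedSpace.incl b Λ hΛ) :=
  Subtype.val_injective

lemma WeightedSpace.coeff_apply (i : ι) (f : WeightedSpace b Λ hΛ) :
    WeightedSpace.coeff b Λ hΛ i f = inner ℝ (b i) (WeightedSpace.incl b Λ hΛ f) := rfl

lemma WeightedSpace.summable_sq (f : WeightedSpace b Λ hΛ) :
    Summable fun i => Λ i * WeightedSpace.coeff b Λ hΛ i f ^ 2 := f.2

lemma WeightedSpace.summable_mul (f g : WeightedSpace b Λ hΛ) :
    Summable fun i => Λ i * (WeightedSpace.coeff b Λ hΛ i f * WeightedSpace.coeff b Λ hΛ i g) :=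
  summable_weighted_mul hΛ f.summable_sq g.summable_sq

lemma WeightedSpace.ext_coeff {f : WeightedSpace b Λ hΛ}
    (h : ∀ i, WeightedSpace.coeff b Λ hΛ i f = 0) : f = 0 := by
  refine WeightedSpace.incl_injective ?_
  rw [map_zero]
  refine b.repr.injective ?_
  ext i
  rw [map_zero, b.repr_apply_apply]
  exact h i

variable (b Λ hΛ)

/-- The scalar product `⟨f, g⟩ = ∑ i, Λ i * f_i * g_i`. -/
@[reducible]
def WeightedSpace.core : InnerProductSpace.Core ℝ (WeightedSpace b Λ hΛ) where
  inner f g := ∑' i, Λ i * (WeightedSpace.coeff b Λ hΛ i f * WeightedSpace.coeff b Λ hΛ i g)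
  conj_inner_symm f g := by simp [mul_comm]
  re_inner_nonneg f := tsum_nonneg fun i =>
    mul_nonneg (zero_le_one.trans (hΛ i)) (mul_self_nonneg _)
  add_left f g h := by
    rw [← (f.summable_mul h).tsum_add (g.summable_mul h)]
    refine tsum_congr fun i => ?_
    rw [map_add]; ring
  smul_left f g c := by
    simp only [conj_trivial]
    rw [← tsum_mul_left]
    refine tsum_congr fun i => ?_
    rw [map_smul, smul_eq_mul]; ring
  definite f hf := by
    refine WeightedSpace.ext_coeff fun i => ?_
    have h := (hasSum_zero_iff_of_nonneg fun i => mul_nonneg (zero_le_one.trans (hΛ i))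
      (mul_self_nonneg (WeightedSpace.coeff b Λ hΛ i f))).1 (hf ▸ (f.summable_mul f).hasSum)
    have h := congrFun h i
    have h0 : Λ i ≠ 0 := (zero_lt_one.trans_le (hΛ i)).ne'
    simpa [h0] using h

instance : NormedAddCommGroup (WeightedSpace b Λ hΛ) :=
  (WeightedSpace.core b Λ hΛ).toNormedAddCommGroup

instance : InnerProductSpace ℝ (WeightedSpace b Λ hΛ) :=
  InnerProductSpace.ofCore (WeightedSpace.core b Λ hΛ).toCore

variable {b Λ hΛ}

theorem WeightedSpace.inner_def (f g : WeightedSpace b Λ hΛ) : inner ℝ f g =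
    ∑' i, Λ i * (WeightedSpace.coeff b Λ hΛ i f * WeightedSpace.coeff b Λ hΛ i g) := rfl

lemma WeightedSpace.norm_sq (f : WeightedSpace b Λ hΛ) :
    ‖f‖ ^ 2 = ∑' i, Λ i * WeightedSpace.coeff b Λ hΛ i f ^ 2 := by
  rw [← real_inner_self_eq_norm_sq, WeightedSpace.inner_def]
  simp_rw [sq]

lemma WeightedSpace.norm_incl_le (f : WeightedSpace b Λ hΛ) :
    ‖WeightedSpace.incl b Λ hΛ f‖ ≤ 1 * ‖f‖ := by
  rw [one_mul]
  refine le_of_sq_le_sq ?_ (norm_nonneg _)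
  have h := b.hasSum_inner_mul_inner (WeightedSpace.incl b Λ hΛ f) (WeightedSpace.incl b Λ hΛ f)
  rw [← real_inner_self_eq_norm_sq, ← h.tsum_eq, WeightedSpace.norm_sq]
  refine h.summable.tsum_le_tsum (fun i => ?_) f.summable_sq
  rw [real_inner_comm, ← WeightedSpace.coeff_apply, ← sq]
  exact le_mul_of_one_le_left (sq_nonneg _) (hΛ i)

variable (b Λ hΛ)

/-- The embedding of the weighted space into the ambient space, as a bounded operator. -/
def WeightedSpace.embedding : WeightedSpace b Λ hΛ →L[ℝ] E :=
  (WeightedSpace.incl b Λ hΛ).mkContinuous 1 WeightedSpace.norm_incl_le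

variable {b Λ hΛ}

/-- Every square summable family is, after division by `√Λ`, a family of Fourier coefficients. -/
lemma WeightedSpace.exists_coeff [CompleteSpace E] (c : ι → ℝ)
    (hc : Summable fun i => Λ i * c i ^ 2) :
    ∃ f : WeightedSpace b Λ hΛ, ∀ i, WeightedSpace.coeff b Λ hΛ i f = c i := by
  have hc2 : Memℓp c 2 := by
    refine memℓp_gen ?_
    refine Summable.of_nonneg_of_le (fun i => by positivity) (fun i => ?_) hc
    norm_num
    exact le_mul_of_one_le_left (sq_nonneg _) (hΛ i)
  let F : E := b.repr.symm ⟨c, hc2⟩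
  have hF : ∀ i, inner ℝ (b i) F = c i := fun i => by
    rw [← b.repr_apply_apply, LinearIsometryEquiv.apply_symm_apply]
  have hmem : F ∈ weightedSubmodule b Λ hΛ := by
    change Summable fun i => Λ i * inner ℝ (b i) F ^ 2
    simpa only [hF] using hc
  exact ⟨⟨F, hmem⟩, hF⟩

instance [CompleteSpace E] : CompleteSpace (WeightedSpace b Λ hΛ) := by
  have hpos : ∀ i, 0 < Λ i := fun i => zero_lt_one.trans_le (hΛ i)
  have hmem : ∀ f : WeightedSpace b Λ hΛ,
      Memℓp (fun i => √(Λ i) * WeightedSpace.coeff b Λ hΛ i f) 2 := fun f => by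
    refine memℓp_gen (f.summable_sq.congr fun i => ?_)
    norm_num
    rw [mul_pow, sq_abs, sq_abs, Real.sq_sqrt (hpos i).le]
  let J : WeightedSpace b Λ hΛ →ₗ[ℝ] lp (fun _ : ι => ℝ) 2 :=
    { toFun := fun f => ⟨_, hmem f⟩
      map_add' := fun f g => by
        ext i
        change √(Λ i) * WeightedSpace.coeff b Λ hΛ i (f + g) =
          √(Λ i) * WeightedSpace.coeff b Λ hΛ i f + √(Λ i) * WeightedSpace.coeff b Λ hΛ i g
        rw [map_add, mul_add]
      map_smul' := fun c f => by
        ext i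
        change √(Λ i) * WeightedSpace.coeff b Λ hΛ i (c • f) =
          c * (√(Λ i) * WeightedSpace.coeff b Λ hΛ i f)
        rw [map_smul, smul_eq_mul]; ring }
  have hJ : ∀ f i, J f i = √(Λ i) * WeightedSpace.coeff b Λ hΛ i f := fun _ _ => rfl
  have hnorm : ∀ f, ‖J f‖ = ‖f‖ := fun f => by
    rw [← sq_eq_sq₀ (norm_nonneg _) (norm_nonneg _), WeightedSpace.norm_sq,
      ← real_inner_self_eq_norm_sq, lp.inner_eq_tsum]
    refine tsum_congr fun i => ?_
    rw [real_inner_self_eq_norm_sq, hJ, Real.norm_eq_abs, sq_abs, mul_pow,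
      Real.sq_sqrt (hpos i).le]
  have hsurj : Function.Surjective J := fun y => by
    have hy : Summable fun i => Λ i * ((√(Λ i))⁻¹ * y i) ^ 2 := by
      have h := (lp.hasSum_inner (𝕜 := ℝ) y y).summable
      refine h.congr fun i => ?_
      rw [real_inner_self_eq_norm_sq, Real.norm_eq_abs, sq_abs, mul_pow, inv_pow,
        Real.sq_sqrt (hpos i).le, mul_inv_cancel_left₀ (hpos i).ne']
    obtain ⟨f, hf⟩ := WeightedSpace.exists_coeff (b := b) (hΛ := hΛ) _ hy
    refine ⟨f, ?_⟩
    ext i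
    rw [hJ, hf, mul_inv_cancel_left₀ (Real.sqrt_pos.2 (hpos i)).ne']
  let e : WeightedSpace b Λ hΛ ≃ₗᵢ[ℝ] lp (fun _ : ι => ℝ) 2 :=
    LinearIsometryEquiv.ofSurjective ⟨J, hnorm⟩ hsurj
  exact (completeSpace_congr (e := e.toEquiv) e.isometry.isUniformEmbedding).2 inferInstance

end Weighted

/-! ### Spaces of Jacobi functions -/

lemma Param.one_le_weight (p : Param) {s : ℝ} (hs : 0 < s) (k : ℕ) :
    (1 : ℝ) ≤ (1 + p.a⁻¹ * k) ^ (2 * s) := by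
  have : 0 < p.a := p.ha
  exact Real.one_le_rpow (le_add_of_nonneg_right (by positivity)) (by positivity)

lemma Param.one_le_prod_weight (p : Param) {s : ℝ} (hs : 0 < s) {d : ℕ} (k : Fin d → ℕ) :
    (1 : ℝ) ≤ ∏ j, (1 + p.a⁻¹ * k j) ^ (2 * s) :=
  Finset.prod_induction _ (fun x : ℝ => 1 ≤ x) (fun _ _ => one_le_mul_of_one_le_of_one_le) le_rfl
    fun j _ => p.one_le_weight hs (k j)

/-- The univariate space `K^s([-1, 1], w)`. -/
abbrev JacobiSpace (p : Param) {s : ℝ} (hs : 0 < s) : Type :=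
  WeightedSpace (basis p) (fun k => (1 + p.a⁻¹ * k) ^ (2 * s)) fun k => p.one_le_weight hs k

/-- The space `K^s([-1, 1] ^ d, w_d)` of Jacobi functions of mixed order `s`. -/
abbrev MixedJacobiSpace (p : Param) {s : ℝ} (hs : 0 < s) (d : ℕ) : Type :=
  WeightedSpace (cubeBasis p d) (fun k => ∏ j, (1 + p.a⁻¹ * k j) ^ (2 * s))
    fun k => p.one_le_prod_weight hs k

/-- The embedding `K^s([-1, 1], w) ↪ L_2([-1, 1], w)`. -/
def jacobiEmbedding (p : Param) {s : ℝ} (hs : 0 < s) :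
    JacobiSpace p hs →L[ℝ] Lp ℝ 2 (measure p) :=
  WeightedSpace.embedding _ _ _

/-- The embedding `K^s([-1, 1] ^ d, w_d) ↪ L_2([-1, 1] ^ d, w_d)`. -/
def mixedJacobiEmbedding (p : Param) {s : ℝ} (hs : 0 < s) (d : ℕ) :
    MixedJacobiSpace p hs d →L[ℝ] Lp ℝ 2 (cubeMeasure p d) :=
  WeightedSpace.embedding _ _ _

/-- The `n`-th approximation number `a_n(T) = inf {‖T - A‖ : rank A < n}`. -/
def approxNumber {X Y : Type*} [NormedAddCommGroup X] [NormedSpace ℝ X] [NormedAddCommGroup Y]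
    [NormedSpace ℝ Y] (T : X →L[ℝ] Y) (n : ℕ) : ℝ :=
  sInf {r | ∃ A : X →L[ℝ] Y, LinearMap.rank A.toLinearMap < n ∧ ‖T - A‖ = r}

/-! ### The mixed order space is the tensor power of the univariate space -/

lemma hasSum_pi_prod {d : ℕ} (u : Fin d → ℕ → ℝ) (hu : ∀ j, Summable (u j)) :
    HasSum (fun k : Fin d → ℕ => ∏ j, u j (k j)) (∏ j, ∑' n, u j n) := by
  induction d with
  | zero => simp [hasSum_unique]
  | succ d ih =>
    have h := ih (fun j => u j.succ) fun j => hu j.succ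
    have h1 := summable_mul_of_summable_norm (hu 0).norm h.summable.norm
    have h2 := (hu 0).hasSum.mul h h1
    rw [Fin.prod_univ_succ, ← (Fin.consEquiv fun _ => ℕ).hasSum_iff]
    have hfun : (fun k : Fin (d + 1) → ℕ => ∏ j, u j (k j)) ∘ (Fin.consEquiv fun _ => ℕ) =
        fun x => u 0 x.1 * ∏ j, u j.succ (x.2 j) := by
      funext x
      simp [Fin.prod_univ_succ]
    rw [hfun]
    exact h2

lemma memLp_tensor (p : Param) {d : ℕ} (f : Fin d → Lp ℝ 2 (measure p)) :
    MemLp (fun x : Fin d → ℝ => ∏ j, f j (x j)) 2 (cubeMeasure p d) := by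
  rw [cubeMeasure_eq_pi]
  have hm : AEStronglyMeasurable (fun x : Fin d → ℝ => ∏ j, f j (x j))
      (Measure.pi fun _ => measure p) := by
    refine Finset.aestronglyMeasurable_fun_prod _ fun j _ => ?_
    exact (Lp.aestronglyMeasurable (f j)).comp_quasiMeasurePreserving
      (Measure.quasiMeasurePreserving_eval _ j)
  rw [memLp_two_iff_integrable_sq hm]
  simp_rw [← Finset.prod_pow]
  exact Integrable.fintype_prod (f := fun j x => f j x ^ 2) fun j => (Lp.memLp (f j)).integrable_sq

lemma basis_coe (p : Param) : ⇑(basis p) = basisVec p :=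
  HilbertBasis.coe_mkOfOrthogonalEqBot _ _

lemma cubeBasis_coe (p : Param) (d : ℕ) : ⇑(cubeBasis p d) = cubeBasisVec p d :=
  HilbertBasis.coe_mkOfOrthogonalEqBot _ _

/-- Fourier coefficients with respect to the normalized Jacobi basis as integrals. -/
theorem inner_basis (p : Param) (k : ℕ) (f : Lp ℝ 2 (measure p)) :
    inner ℝ (basis p k) f = ∫ x, f x * basisFun p k x ∂measure p := by
  rw [basis_coe, inner_basisVec]

theorem inner_cubeBasis (p : Param) (d : ℕ) (k : Fin d → ℕ) (f : Lp ℝ 2 (cubeMeasure p d)) :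
    inner ℝ (cubeBasis p d k) f =
      ∫ x, f x * ∏ j, basisFun p (k j) (x j) ∂cubeMeasure p d := by
  rw [cubeBasis_coe, inner_cubeBasisVec]
  rfl

/-- `K^s([-1, 1] ^ d, w_d)` is the `d`-th Hilbert space tensor power of `K^s([-1, 1], w)`: it
contains the tensor products of univariate functions, its scalar product is multiplicative on them,
and their span is dense. -/
theorem mixedJacobiSpace_tensorPower (p : Param) {s : ℝ} (hs : 0 < s) (d : ℕ) :
    ∃ t : (Fin d → JacobiSpace p hs) → MixedJacobiSpace p hs d,
      (∀ f, mixedJacobiEmbedding p hs d (t f) =ᵐ[cubeMeasure p d]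
        fun x => ∏ j, jacobiEmbedding p hs (f j) (x j)) ∧
      (∀ f g, inner ℝ (t f) (t g) = ∏ j, inner ℝ (f j) (g j)) ∧
      (Submodule.span ℝ (Set.range t)).topologicalClosure = ⊤ := by
  have hco : ∀ (f : Fin d → JacobiSpace p hs) (k : Fin d → ℕ),
      inner ℝ (cubeBasis p d k) (memLp_tensor p fun j => jacobiEmbedding p hs (f j)).toLp =
        ∏ j, WeightedSpace.coeff _ _ _ (k j) (f j) := fun f k => by
    rw [inner_cubeBasis]
    have h1 : ∀ j, WeightedSpace.coeff _ _ _ (k j) (f j) =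
        ∫ x, jacobiEmbedding p hs (f j) x * basisFun p (k j) x ∂measure p := fun j => by
      rw [WeightedSpace.coeff_apply, inner_basis]; rfl
    simp_rw [h1]
    rw [← integral_fintype_prod_eq_prod
      (f := fun j x => jacobiEmbedding p hs (f j) x * basisFun p (k j) x), ← cubeMeasure_eq_pi]
    refine integral_congr_ae ?_
    filter_upwards [(memLp_tensor p fun j => jacobiEmbedding p hs (f j)).coeFn_toLp] with x hx
    rw [hx, Finset.prod_mul_distrib]
  have hmem : ∀ f : Fin d → JacobiSpace p hs,
      (memLp_tensor p fun j => jacobiEmbedding p hs (f j)).toLp ∈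
        weightedSubmodule (cubeBasis p d) _ fun k => p.one_le_prod_weight hs k := fun f => by
    change Summable _
    simp only [hco]
    refine (hasSum_pi_prod _ fun j => (f j).summable_sq).summable.congr fun k => ?_
    rw [Finset.prod_mul_distrib, Finset.prod_pow]
  let t : (Fin d → JacobiSpace p hs) → MixedJacobiSpace p hs d := fun f => ⟨_, hmem f⟩
  have ht : ∀ f k, WeightedSpace.coeff _ _ _ k (t f) =
      ∏ j, WeightedSpace.coeff _ _ _ (k j) (f j) := hco
  refine ⟨t, fun f => (memLp_tensor p fun j => jacobiEmbedding p hs (f j)).coeFn_toLp, fun f g => ?_, ?_⟩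
  · simp_rw [WeightedSpace.inner_def]
    rw [← (hasSum_pi_prod _ fun j => (f j).summable_mul (g j)).tsum_eq]
    refine tsum_congr fun k => ?_
    rw [ht, ht, Finset.prod_mul_distrib, Finset.prod_mul_distrib]
  · rw [Submodule.topologicalClosure_eq_top_iff, Submodule.eq_bot_iff]
    intro F hF
    refine WeightedSpace.ext_coeff fun k => ?_
    have he : ∀ m : ℕ, ∃ f : JacobiSpace p hs, ∀ i, WeightedSpace.coeff _ _ _ i f =
        (Pi.single m 1 : ℕ → ℝ) i := fun m => by
      refine WeightedSpace.exists_coeff _ (summable_of_ne_finset_zero (s := {m}) fun i hi => ?_)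
      have : i ≠ m := by simpa using hi
      simp [this]
    choose e he using he
    have h0 : inner ℝ (t fun j => e (k j)) F = 0 := hF _ (Submodule.subset_span ⟨_, rfl⟩)
    rw [WeightedSpace.inner_def, tsum_eq_single k] at h0
    · have hpos := zero_lt_one.trans_le (p.one_le_prod_weight hs k)
      rw [ht] at h0
      simpa [he, hpos.ne'] using h0
    · intro l hl
      obtain ⟨j, hj⟩ := Function.ne_iff.1 hl
      have hz : ∏ j, WeightedSpace.coeff _ _ _ (l j) (e (k j)) = 0 :=
        Finset.prod_eq_zero (Finset.mem_univ j) (by simp [he, hj])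
      rw [ht, hz, zero_mul, mul_zero]

end Jacobi

end

noncomputable section

open MeasureTheory Polynomial
open scoped ENNReal

namespace Jacobi

/-! ### Approximation numbers of diagonal embeddings -/

section ApproxNumber

variable {ι E : Type*} [NormedAddCommGroup E] [InnerProductSpace ℝ E]
  {b : HilbertBasis ι ℝ E} {Λ : ι → ℝ} {hΛ : ∀ i, 1 ≤ Λ i}

/-! Of the Jacobi polynomials only one fact is used: their tensor products form an orthonormal basis
of the target space. In this basis the embedding is diagonal, with singular values `∏ j, (1 + k_j /
a) ^ (-s)`, so its approximation numbers are these values in decreasing order. The rearrangement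
itself is never written down. It is replaced by two one-sided statements about the number `N(t)` of
indices with `∏ j, (1 + k_j / a) ≤ t`: if `N(t) < n`, truncation to these indices gives `a_n ≤ t ^
(-s)` (`approxNumber_embedding_le`); if `N(t) ≥ n ≥ 1`, an operator of rank less than `n` kills a
nonzero vector with frequencies in this set, which gives `a_n ≥ t ^ (-s)`
(`le_approxNumber_embedding`).

It remains to count points of a hyperbolic cross. Slicing along the first coordinate expresses the
count in dimension `d + 1` as a sum of counts in dimension `d` at the sizes `t / (1 + m / a)`. If
the latter grow like `C t (log t) ^ (d - 1)`, the sum is `C t` times a Riemann sum of `x⁻¹ (log (t /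
x)) ^ (d - 1)` with spacing `1 / a`, hence about `C t (a / d) (log t) ^ d`. By induction `N(t) ~ a ^
d / (d - 1)! * t (log t) ^ (d - 1)` (`card_cross_bound`, `tendsto_card_cross`).

To pass from `N` back to `a_n`, put `t = n / (c (log n) ^ (d - 1))`. Then `N(t) / n` tends to `C /
c` with `C = a ^ d / (d - 1)!` (`tendsto_card_cross_div`), while `t ^ (-s)` becomes exactly `c ^ s`
after normalization. Values of `c` slightly below and slightly above `C` give the two bounds for the
limit. -/

lemma hasSum_inner_sq (b : HilbertBasis ι ℝ E) (x : E) :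
    HasSum (fun i => inner ℝ (b i) x ^ 2) (‖x‖ ^ 2) := by
  have h := b.hasSum_inner_mul_inner x x
  rw [real_inner_self_eq_norm_sq] at h
  refine h.congr_fun fun i => ?_
  rw [real_inner_comm, sq]

lemma WeightedSpace.embedding_apply (f : WeightedSpace b Λ hΛ) :
    WeightedSpace.embedding b Λ hΛ f = WeightedSpace.incl b Λ hΛ f := rfl

/-- The orthogonal projection onto the span of the basis vectors with index in `F`. -/
def partialSum (b : HilbertBasis ι ℝ E) (F : Finset ι) : E →L[ℝ] E :=
  ∑ i ∈ F, (innerSL ℝ (b i)).smulRight (b i)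

lemma partialSum_apply (F : Finset ι) (x : E) :
    partialSum b F x = ∑ i ∈ F, inner ℝ (b i) x • b i := by
  simp [partialSum]

lemma inner_sub_partialSum [DecidableEq ι] (F : Finset ι) (x : E) (i : ι) :
    inner ℝ (b i) (x - partialSum b F x) = if i ∈ F then 0 else inner ℝ (b i) x := by
  rw [inner_sub_right, partialSum_apply, inner_sum]
  simp_rw [inner_smul_right, orthonormal_iff_ite.1 b.orthonormal]
  split_ifs with h <;> simp [h]

lemma rank_partialSum_comp_le {X : Type*} [NormedAddCommGroup X] [NormedSpace ℝ X]
    (F : Finset ι) (T : X →L[ℝ] E) :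
    LinearMap.rank ((partialSum b F).comp T).toLinearMap ≤ F.card := by
  classical
  have hle : LinearMap.range ((partialSum b F).comp T).toLinearMap ≤
      Submodule.span ℝ (F.image b : Set E) := by
    rintro _ ⟨x, rfl⟩
    change partialSum b F (T x) ∈ _
    rw [partialSum_apply]
    refine Submodule.sum_mem _ fun i hi => Submodule.smul_mem _ _ (Submodule.subset_span ?_)
    exact Finset.mem_coe.2 (Finset.mem_image_of_mem _ hi)
  refine (Submodule.rank_mono hle).trans ((rank_span_finset_le _).trans ?_)
  exact_mod_cast Finset.card_image_le

/-- Upper bound for the approximation numbers by truncation. -/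
theorem approxNumber_embedding_le {F : Finset ι} {r : ℝ} (hr : 0 ≤ r)
    (hF : ∀ i ∉ F, 1 ≤ r ^ 2 * Λ i) {n : ℕ} (hn : F.card < n) :
    approxNumber (WeightedSpace.embedding b Λ hΛ) n ≤ r := by
  classical
  set T := WeightedSpace.embedding b Λ hΛ
  have hbdd : BddBelow {r | ∃ A : WeightedSpace b Λ hΛ →L[ℝ] E,
      LinearMap.rank A.toLinearMap < n ∧ ‖T - A‖ = r} :=
    ⟨0, by rintro _ ⟨A, -, rfl⟩; exact norm_nonneg (T - A)⟩
  refine (csInf_le hbdd ⟨(partialSum b F).comp T, ?_, rfl⟩).trans ?_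
  · exact (rank_partialSum_comp_le F T).trans_lt (by exact_mod_cast hn)
  refine ContinuousLinearMap.opNorm_le_bound _ hr fun f => ?_
  refine le_of_sq_le_sq ?_ (by positivity)
  -- Parseval turns both sides into series over the index set, compared term by term: indices in `F`
  -- contribute zero to the error, and for all others `1 ≤ r ^ 2 * Λ i`.
  rw [mul_pow, WeightedSpace.norm_sq, ← tsum_mul_left]
  have h := hasSum_inner_sq b ((T - (partialSum b F).comp T) f)
  rw [← h.tsum_eq]
  refine h.summable.tsum_le_tsum (fun i => ?_) (f.summable_sq.mul_left _)
  change inner ℝ (b i) (T f - partialSum b F (T f)) ^ 2 ≤ _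
  have h0 := zero_le_one.trans (hΛ i)
  rw [inner_sub_partialSum]
  split_ifs with hi
  · rw [zero_pow two_ne_zero]; positivity
  · rw [← mul_assoc]
    exact le_mul_of_one_le_left (sq_nonneg _) (hF i hi)

/-- Lower bound for the approximation numbers: an operator of rank less than `F.card` vanishes at a
nonzero combination of the basis vectors with index in `F`. -/
theorem le_approxNumber_embedding [CompleteSpace E] {F : Finset ι} {r : ℝ}
    (hF : ∀ i ∈ F, r ^ 2 * Λ i ≤ 1) {n : ℕ} (hn0 : 0 < n) (hn : n ≤ F.card) :
    r ≤ approxNumber (WeightedSpace.embedding b Λ hΛ) n := by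
  classical
  set T := WeightedSpace.embedding b Λ hΛ
  -- The zero operator is admissible because `0 < n`. For `n = 0` no operator is, and the infimum
  -- would take the default value `0`.
  refine le_csInf ⟨_, 0, ?_, rfl⟩ ?_
  · have : ((0 : WeightedSpace b Λ hΛ →L[ℝ] E) : WeightedSpace b Λ hΛ →ₗ[ℝ] E) = 0 := rfl
    rw [this, LinearMap.rank_zero]
    exact_mod_cast hn0
  rintro _ ⟨A, hA, rfl⟩
  have he : ∀ m : ι, ∃ f : WeightedSpace b Λ hΛ, ∀ i, WeightedSpace.coeff b Λ hΛ i f =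
      (Pi.single m 1 : ι → ℝ) i := fun m => by
    refine WeightedSpace.exists_coeff _ (summable_of_ne_finset_zero (s := {m}) fun i hi => ?_)
    have : i ≠ m := by simpa using hi
    simp [this]
  choose e he using he
  -- `Φ` sends a vector of `F.card` numbers to the element with these Fourier coefficients. If `A ∘
  -- Φ` were injective its rank would be `F.card ≥ n`, contrary to the rank of `A`; so some `c ≠ 0`
  -- has `A (Φ c) = 0`.
  let Φ : (F → ℝ) →ₗ[ℝ] WeightedSpace b Λ hΛ := Fintype.linearCombination ℝ fun i : F => e i
  have hrank : LinearMap.rank (A.toLinearMap ∘ₗ Φ) < n :=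
    (LinearMap.rank_comp_le_left Φ A.toLinearMap).trans_lt hA
  obtain ⟨c, hc, hc0⟩ : ∃ c, (A.toLinearMap ∘ₗ Φ) c = 0 ∧ c ≠ 0 := by
    by_contra! hcon
    have hinj : Function.Injective (A.toLinearMap ∘ₗ Φ) :=
      (injective_iff_map_eq_zero _).2 hcon
    have h1 : LinearMap.rank (A.toLinearMap ∘ₗ Φ) = F.card := by
      have := lift_rank_range_of_injective _ hinj
      simpa [LinearMap.rank] using this
    rw [h1] at hrank
    exact absurd (by exact_mod_cast hrank) hn.not_gt
  have hco : ∀ i, WeightedSpace.coeff b Λ hΛ i (Φ c) = if h : i ∈ F then c ⟨i, h⟩ else 0 := by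
    intro i
    simp only [Φ, Fintype.linearCombination_apply, map_sum, map_smul, he, smul_eq_mul]
    split_ifs with h
    · rw [Finset.sum_eq_single ⟨i, h⟩]
      · simp
      · rintro ⟨j, hj⟩ - hne
        have : i ≠ j := fun h => hne (by simp [h])
        simp [this]
      · simp
    · refine Finset.sum_eq_zero ?_
      rintro ⟨j, hj⟩ -
      have : i ≠ j := fun h' => h (h' ▸ hj)
      simp [this]
  -- All coefficients of `Φ c` live on `F`, where `r ^ 2 * Λ i ≤ 1`.
  have hle : r ^ 2 * ‖Φ c‖ ^ 2 ≤ ‖T (Φ c)‖ ^ 2 := by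
    have h := hasSum_inner_sq b (T (Φ c))
    rw [WeightedSpace.norm_sq, ← tsum_mul_left, ← h.tsum_eq]
    refine ((Φ c).summable_sq.mul_left _).tsum_le_tsum (fun i => ?_) h.summable
    change _ ≤ WeightedSpace.coeff b Λ hΛ i (Φ c) ^ 2
    by_cases hi : i ∈ F
    · rw [← mul_assoc]
      exact mul_le_of_le_one_left (sq_nonneg _) (hF i hi)
    · simp [hco, hi]
  have hpos : 0 < ‖Φ c‖ := by
    refine norm_pos_iff.2 fun h0 => hc0 (funext fun i => ?_)
    have := hco i
    simpa [h0] using this.symm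
  have hle' : r * ‖Φ c‖ ≤ ‖T (Φ c)‖ := by
    refine le_of_sq_le_sq ?_ (norm_nonneg _)
    rwa [mul_pow]
  -- On `Φ c` the operators `T - A` and `T` agree, so this vector witnesses `r ≤ ‖T - A‖`.
  refine le_of_mul_le_mul_right (hle'.trans ?_) hpos
  have h := (T - A).le_opNorm (Φ c)
  have h2 : (T - A) (Φ c) = T (Φ c) := by
    have : A (Φ c) = 0 := hc
    simp [this]
  rwa [h2] at h

end ApproxNumber

/-! ### Counting points of hyperbolic crosses -/

section Counting

/-- The points `k` with `∏ j, (1 + k_j / a) ≤ t`. -/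
def cross (a : ℝ) (d : ℕ) (t : ℝ) : Finset (Fin d → ℕ) :=
  {k ∈ Fintype.piFinset fun _ => Finset.range (⌊a * (t - 1)⌋₊ + 1) | ∏ j, (1 + a⁻¹ * k j) ≤ t}

variable {a : ℝ}

lemma one_le_prod_one_add (ha : 0 < a) {d : ℕ} (k : Fin d → ℕ) :
    1 ≤ ∏ j, (1 + a⁻¹ * (k j : ℝ)) :=
  Finset.prod_induction _ (fun x : ℝ => 1 ≤ x) (fun _ _ => one_le_mul_of_one_le_of_one_le) le_rfl
    fun j _ => le_add_of_nonneg_right (by positivity)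

/-- For `t < 1` the natural floor is `0`, so the range would still contain `k = 0`, although the
inequality fails there. -/
lemma one_add_le_iff (ha : 0 < a) {t : ℝ} (ht : 1 ≤ t) (k : ℕ) :
    1 + a⁻¹ * (k : ℝ) ≤ t ↔ k ∈ Finset.range (⌊a * (t - 1)⌋₊ + 1) := by
  rw [Finset.mem_range, Nat.lt_succ_iff, Nat.le_floor_iff (mul_nonneg ha.le (by linarith)),
    ← le_sub_iff_add_le', inv_mul_le_iff₀ ha]

/-- The box in `cross` only serves to make it a finset. All factors are at least `1`, so a product
at most `t` forces every single factor to be at most `t`, which is the box condition. -/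
lemma mem_cross (ha : 0 < a) {d : ℕ} {t : ℝ} {k : Fin d → ℕ} :
    k ∈ cross a d t ↔ ∏ j, (1 + a⁻¹ * (k j : ℝ)) ≤ t := by
  rw [cross, Finset.mem_filter, and_iff_right_iff_imp, Fintype.mem_piFinset]
  intro h i
  have h1 : (1 : ℝ) ≤ t := (one_le_prod_one_add ha k).trans h
  rw [← one_add_le_iff ha h1]
  refine le_trans ?_ h
  rw [← Finset.mul_prod_erase _ _ (Finset.mem_univ i)]
  refine le_mul_of_one_le_right (by positivity) ?_
  exact Finset.prod_induction _ (fun x : ℝ => 1 ≤ x)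
    (fun _ _ => one_le_mul_of_one_le_of_one_le) le_rfl
    fun j _ => le_add_of_nonneg_right (by positivity)

/-- Slice by the first coordinate `m`: dividing by its factor leaves the same condition on the other
coordinates, at size `t / (1 + m / a)`. -/
lemma card_cross_succ (ha : 0 < a) (d : ℕ) (t : ℝ) :
    (cross a (d + 1) t).card =
      ∑ m ∈ Finset.range (⌊a * (t - 1)⌋₊ + 1), (cross a d (t / (1 + a⁻¹ * m))).card := by
  classical
  rw [Finset.card_eq_sum_card_fiberwise (f := fun k => k 0)
    (t := Finset.range (⌊a * (t - 1)⌋₊ + 1))]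
  · refine Finset.sum_congr rfl fun m _ => ?_
    have hm : (0 : ℝ) < 1 + a⁻¹ * m := by positivity
    symm
    refine Finset.card_bij (fun k _ => Fin.cons m k) ?_ ?_ ?_
    · intro k hk
      rw [mem_cross ha, le_div_iff₀' hm] at hk
      rw [Finset.mem_filter, mem_cross ha, Fin.prod_univ_succ]
      simpa using hk
    · intro k _ l _ h
      exact Fin.cons_right_injective (α := fun _ => ℕ) m h
    · intro k hk
      rw [Finset.mem_filter, mem_cross ha, Fin.prod_univ_succ] at hk
      obtain ⟨h1, h2⟩ := hk
      refine ⟨Fin.tail k, ?_, ?_⟩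
      · rw [mem_cross ha, le_div_iff₀' hm]
        simpa [← h2, Fin.tail] using h1
      · rw [← h2]; exact Fin.cons_self_tail k
  · intro k hk
    have h := (Fintype.mem_piFinset.1 (Finset.mem_filter.1 (Finset.mem_coe.1 hk)).1) 0
    exact Finset.mem_coe.2 h

lemma card_cross_zero (ha : 0 < a) {t : ℝ} (ht : 1 ≤ t) : (cross a 0 t).card = 1 := by
  rw [Finset.card_eq_one]
  refine ⟨default, ?_⟩
  ext k
  simp [mem_cross ha, ht, Subsingleton.elim k default]

/-- The difference is `A - B` times `∑ A ^ i B ^ (d - i)`, whose `d + 1` summands lie between `B ^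
d` and `A ^ d`. This plays the role of the mean value theorem. -/
lemma pow_succ_sub_le {A B : ℝ} (hB : 0 ≤ B) (hAB : B ≤ A) (d : ℕ) :
    A ^ (d + 1) - B ^ (d + 1) ≤ (d + 1) * (A - B) * A ^ d ∧
      (d + 1) * (A - B) * B ^ d ≤ A ^ (d + 1) - B ^ (d + 1) := by
  have hA : 0 ≤ A := hB.trans hAB
  induction d with
  | zero => simp
  | succ d ih =>
    obtain ⟨h1, h2⟩ := ih
    -- Two splittings of the same difference: `e` suits the induction for the upper bound, `e'` the
    -- one for the lower bound.
    have e : A ^ (d + 1 + 1) - B ^ (d + 1 + 1) =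
      A * (A ^ (d + 1) - B ^ (d + 1)) + (A - B) * B ^ (d + 1) := by ring
    have e' : A ^ (d + 1 + 1) - B ^ (d + 1 + 1) =
      B * (A ^ (d + 1) - B ^ (d + 1)) + (A - B) * A ^ (d + 1) := by ring
    have h3 := mul_le_mul_of_nonneg_left h1 hA
    have h4 := mul_le_mul_of_nonneg_left h2 hB
    have h5 : (A - B) * B ^ (d + 1) ≤ (A - B) * A ^ (d + 1) :=
      mul_le_mul_of_nonneg_left (pow_le_pow_left₀ hB hAB _) (by linarith)
    push_cast
    constructor
    · rw [e]
      calc _ ≤ A * ((d + 1) * (A - B) * A ^ d) + (A - B) * A ^ (d + 1) := add_le_add h3 h5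
        _ = _ := by ring
    · rw [e']
      calc _ = B * ((d + 1) * (A - B) * B ^ d) + (A - B) * B ^ (d + 1) := by ring
        _ ≤ _ := add_le_add h4 h5

/-- The antiderivative of `x⁻¹ (log (t / x)) ^ d` bounds this decreasing function. -/
lemma log_pow_sub_le {t x y : ℝ} (hx : 0 < x) (hxy : x ≤ y) (hy : y ≤ t) (d : ℕ) :
    Real.log (t / x) ^ (d + 1) - Real.log (t / y) ^ (d + 1) ≤
        (d + 1) * (y - x) * (x⁻¹ * Real.log (t / x) ^ d) ∧
      (d + 1) * (y - x) * (y⁻¹ * Real.log (t / y) ^ d) ≤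
        Real.log (t / x) ^ (d + 1) - Real.log (t / y) ^ (d + 1) := by
  have hy0 : 0 < y := hx.trans_le hxy
  have ht0 : 0 < t := hy0.trans_le hy
  have hB : 0 ≤ Real.log (t / y) := Real.log_nonneg ((one_le_div hy0).2 hy)
  have hsub : Real.log (t / x) - Real.log (t / y) = Real.log (y / x) := by
    rw [Real.log_div ht0.ne' hx.ne', Real.log_div ht0.ne' hy0.ne', Real.log_div hy0.ne' hx.ne']
    ring
  have hAB : Real.log (t / y) ≤ Real.log (t / x) := by
    rw [← sub_nonneg, hsub]
    exact Real.log_nonneg ((one_le_div hx).2 hxy)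
  obtain ⟨h1, h2⟩ := pow_succ_sub_le hB hAB d
  rw [hsub] at h1 h2
  -- The bounds `1 - 1 / u ≤ log u ≤ u - 1` at `u = y / x` turn the increment of the logarithm into
  -- the length `y - x` times the value of the reciprocal at an endpoint.
  have hl1 : Real.log (y / x) ≤ (y - x) * x⁻¹ := by
    refine (Real.log_le_sub_one_of_pos (by positivity)).trans_eq ?_
    field_simp
  have hl2 : (y - x) * y⁻¹ ≤ Real.log (y / x) := by
    refine le_trans (le_of_eq ?_) (Real.one_sub_inv_le_log_of_pos (by positivity))
    field_simp
  have hA := hB.trans hAB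
  constructor
  · refine h1.trans ?_
    calc _ ≤ (d + 1) * ((y - x) * x⁻¹) * Real.log (t / x) ^ d := by gcongr
      _ = _ := by ring
  · refine le_trans ?_ h2
    calc _ = (d + 1) * ((y - x) * y⁻¹) * Real.log (t / y) ^ d := by ring
      _ ≤ _ := by gcongr

/-- Comparison of a sum over an arithmetic progression with the integral of
`x⁻¹ (log (t / x)) ^ d`. -/
lemma sum_log_pow_bounds (ha : 0 < a) {t : ℝ} (ht : 1 ≤ t) (d : ℕ) :
    a / (d + 1) * Real.log t ^ (d + 1) ≤
        ∑ m ∈ Finset.range (⌊a * (t - 1)⌋₊ + 1),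
          (1 + a⁻¹ * (m : ℝ))⁻¹ * Real.log (t / (1 + a⁻¹ * m)) ^ d ∧
      ∑ m ∈ Finset.range (⌊a * (t - 1)⌋₊ + 1),
          (1 + a⁻¹ * (m : ℝ))⁻¹ * Real.log (t / (1 + a⁻¹ * m)) ^ d ≤
        a / (d + 1) * Real.log t ^ (d + 1) + Real.log t ^ d := by
  set K := ⌊a * (t - 1)⌋₊ with hK
  let x : ℕ → ℝ := fun m => 1 + a⁻¹ * m
  have hx0 : ∀ m, 0 < x m := fun m => by positivity
  have hstep : ∀ m, x (m + 1) - x m = a⁻¹ := fun m => by simp only [x]; push_cast; ring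
  have hxt : ∀ m ≤ K, x m ≤ t := fun m hm =>
    (one_add_le_iff ha ht m).2 (Finset.mem_range.2 (Nat.lt_succ_of_le hm))
  have hlast : t - x K ≤ a⁻¹ := by
    have h := Nat.lt_floor_add_one (a * (t - 1))
    rw [← hK] at h
    have : t - 1 ≤ a⁻¹ * (K + 1) := by
      rw [← div_eq_inv_mul, le_div_iff₀ ha]; linarith
    simp only [x]; linarith
  have hx00 : x 0 = 1 := by simp [x]
  -- `G m` is `a` times the integral from `x m` to `t` of the function sampled by `g`. The cells
  -- have length `1 / a`, so `G m - G (m + 1)` is the mean over a cell of a decreasing function and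
  -- lies between `g (m + 1)` and `g m`. The sums then telescope.
  let g : ℕ → ℝ := fun m => (x m)⁻¹ * Real.log (t / x m) ^ d
  let G : ℕ → ℝ := fun m => a / (d + 1) * Real.log (t / x m) ^ (d + 1)
  have hcancel : ∀ u : ℝ, a / (d + 1) * ((d + 1) * a⁻¹ * u) = u := fun u => by field_simp
  have hc : 0 ≤ a / ((d : ℝ) + 1) := by positivity
  have hg0 : ∀ m ≤ K, 0 ≤ g m := fun m hm =>
    mul_nonneg (inv_nonneg.2 (hx0 m).le)
      (pow_nonneg (Real.log_nonneg ((one_le_div (hx0 m)).2 (hxt m hm))) _)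
  have hb : ∀ m, m + 1 ≤ K → G m - G (m + 1) ≤ g m ∧ g (m + 1) ≤ G m - G (m + 1) := by
    intro m hm
    have hmm : x m ≤ x (m + 1) := by
      have := hstep m
      have : 0 < a⁻¹ := inv_pos.2 ha
      linarith
    obtain ⟨h1, h2⟩ := log_pow_sub_le (hx0 m) hmm (hxt _ hm) d
    rw [hstep] at h1 h2
    have h1 := mul_le_mul_of_nonneg_left h1 hc
    have h2 := mul_le_mul_of_nonneg_left h2 hc
    rw [hcancel, mul_sub] at h1 h2
    exact ⟨h1, h2⟩
  have htel : ∑ m ∈ Finset.range K, (G m - G (m + 1)) = G 0 - G K := Finset.sum_range_sub' G K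
  have hG0 : G 0 = a / (d + 1) * Real.log t ^ (d + 1) := by simp only [G, hx00, div_one]
  have hg00 : g 0 = Real.log t ^ d := by simp only [g, hx00, div_one, inv_one, one_mul]
  change _ ≤ ∑ m ∈ Finset.range (K + 1), g m ∧ ∑ m ∈ Finset.range (K + 1), g m ≤ _
  rw [← hG0, ← hg00]
  constructor
  · rw [Finset.sum_range_succ]
    have h1 : G 0 - G K ≤ ∑ m ∈ Finset.range K, g m := by
      rw [← htel]
      exact Finset.sum_le_sum fun m hm => (hb m (Finset.mem_range.1 hm)).1
    -- The last, incomplete cell from `x K` to `t` has length at most `1 / a`, and the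
    -- antiderivative vanishes at its right end because `log 1 = 0`.
    have h2 : G K ≤ g K := by
      have h := (log_pow_sub_le (hx0 K) (hxt K le_rfl) le_rfl d).1
      rw [div_self (by linarith), Real.log_one, zero_pow (Nat.succ_ne_zero d), sub_zero] at h
      have h := mul_le_mul_of_nonneg_left h hc
      refine h.trans ?_
      rw [← hcancel (g K)]
      have := hg0 K le_rfl
      change a / (d + 1) * ((d + 1) * (t - x K) * g K) ≤ _
      gcongr
    linarith
  -- The term `g 0` has no cell to its left; it is the extra summand `(log t) ^ d` of the upper
  -- bound.
  · rw [Finset.sum_range_succ']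
    have h1 : ∑ m ∈ Finset.range K, g (m + 1) ≤ G 0 - G K := by
      rw [← htel]
      exact Finset.sum_le_sum fun m hm => (hb m (Finset.mem_range.1 hm)).2
    have h2 : 0 ≤ G K := mul_nonneg hc
      (pow_nonneg (Real.log_nonneg ((one_le_div (hx0 K)).2 (hxt K le_rfl))) _)
    linarith

/-- Lower order terms are absorbed by a small multiple of `t (log t) ^ (d + 1)`. -/
lemma exists_lower_order_bound {ε B : ℝ} (hε : 0 < ε) (hB : 0 ≤ B) (d : ℕ) :
    ∃ M, 0 ≤ M ∧ ∀ t : ℝ, 1 ≤ t →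
      B * t * (Real.log t ^ d + 1) ≤ ε * (t * Real.log t ^ (d + 1)) + M := by
  -- Once `log t ≥ L`, the `1` is at most `(log t) ^ d` and `2 * B ≤ ε * log t`. For smaller `t` the
  -- left side is bounded, and this bound is the constant `M`.
  set L := max 1 (2 * B / ε) with hL
  have hL1 : 1 ≤ L := le_max_left _ _
  refine ⟨B * Real.exp L * (L ^ d + 1), by positivity, fun t ht => ?_⟩
  have hl0 : 0 ≤ Real.log t := Real.log_nonneg ht
  have ht0 : 0 < t := by linarith
  rcases le_total (Real.log t) L with h | h
  · have h1 : t ≤ Real.exp L := (Real.log_le_iff_le_exp ht0).1 h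
    have h2 : B * t * (Real.log t ^ d + 1) ≤ B * Real.exp L * (L ^ d + 1) := by gcongr
    have : 0 ≤ ε * (t * Real.log t ^ (d + 1)) := by positivity
    linarith
  · have h1 : 1 ≤ Real.log t ^ d := one_le_pow₀ (hL1.trans h)
    have h2 : 2 * B ≤ ε * Real.log t := by
      rw [← div_le_iff₀' hε]; exact (le_max_right _ _).trans h
    have h3 : 0 ≤ B * Real.exp L * (L ^ d + 1) := by positivity
    calc B * t * (Real.log t ^ d + 1) ≤ B * t * (Real.log t ^ d + Real.log t ^ d) := by gcongr
      _ = 2 * B * (t * Real.log t ^ d) := by ring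
      _ ≤ ε * Real.log t * (t * Real.log t ^ d) := by gcongr
      _ = ε * (t * Real.log t ^ (d + 1)) := by ring
      _ ≤ _ := by linarith

/-- An asymptotic statement would not survive the induction, since the slices have sizes `t / (1 + m
/ a)` reaching down to nearly `1`. An error bound valid for all `t ≥ 1` can be summed: the constants
`M` of the at most `(a + 1) t` slices add up to `O(t)`, which is of lower order in the next
dimension. -/
lemma card_cross_bound (ha : 0 < a) (d : ℕ) {ε : ℝ} (hε : 0 < ε) :
    ∃ M, 0 ≤ M ∧ ∀ t : ℝ, 1 ≤ t →
      |((cross a (d + 1) t).card : ℝ) - a ^ (d + 1) / d.factorial * (t * Real.log t ^ d)| ≤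
        ε * (t * Real.log t ^ d) + M := by
  have hfl : ∀ t : ℝ, 1 ≤ t → (⌊a * (t - 1)⌋₊ : ℝ) ≤ a * (t - 1) := fun t ht =>
    Nat.floor_le (mul_nonneg ha.le (by linarith))
  induction d generalizing ε with
  | zero =>
    refine ⟨a + 1, by positivity, fun t ht => ?_⟩
    have h : (cross a (0 + 1) t).card = ⌊a * (t - 1)⌋₊ + 1 := by
      rw [card_cross_succ ha, Finset.sum_congr rfl (g := fun _ => 1), Finset.sum_const,
        Finset.card_range, smul_eq_mul, mul_one]
      intro m hm
      refine card_cross_zero ha ((one_le_div (by positivity)).2 ?_)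
      exact (one_add_le_iff ha ht m).2 hm
    have h1 := hfl t ht
    have h2 := Nat.lt_floor_add_one (a * (t - 1))
    have h3 : 0 ≤ ε * t := by positivity
    rw [h, abs_le]
    push_cast
    simp only [pow_one, pow_zero, Nat.factorial_zero, Nat.cast_one, div_one, mul_one]
    constructor <;> linarith
  | succ d ih =>
    set C := a ^ (d + 1) / (d.factorial : ℝ) with hC
    have hC0 : 0 ≤ C := by positivity
    -- The sum `S` below has main term `a / (d + 1) * (log t) ^ (d + 1)`; this `η` makes `η * t * S`
    -- contribute `ε / 2` of the allowed error. The other half absorbs the lower order terms: `η`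
    -- and `C` times the error of `S`, and the slice constants `M * (a + 1) * t`.
    set η := ε * (d + 1) / (2 * a) with hη
    have hη0 : 0 < η := by positivity
    obtain ⟨M, hM0, hM⟩ := ih hη0
    obtain ⟨M', hM'0, hM'⟩ := exists_lower_order_bound (half_pos hε)
      (B := η + C + M * (a + 1)) (by positivity) d
    refine ⟨M', hM'0, fun t ht => ?_⟩
    have ht0 : 0 < t := by linarith
    have hl0 : 0 ≤ Real.log t := Real.log_nonneg ht
    set K := ⌊a * (t - 1)⌋₊ with hK
    set S := ∑ m ∈ Finset.range (K + 1),
      (1 + a⁻¹ * (m : ℝ))⁻¹ * Real.log (t / (1 + a⁻¹ * m)) ^ d with hS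
    obtain ⟨hS1, hS2⟩ := sum_log_pow_bounds ha ht d
    rw [← hK, ← hS] at hS1 hS2
    have hterm : ∀ m : ℕ, t / (1 + a⁻¹ * m) * Real.log (t / (1 + a⁻¹ * m)) ^ d =
        t * ((1 + a⁻¹ * (m : ℝ))⁻¹ * Real.log (t / (1 + a⁻¹ * m)) ^ d) := fun m => by
      rw [div_eq_mul_inv]; ring
    -- The induction hypothesis, summed over the `K + 1` slices.
    have h1 : |((cross a (d + 1 + 1) t).card : ℝ) - C * (t * S)| ≤
        η * (t * S) + M * (K + 1) := by
      rw [card_cross_succ ha, Nat.cast_sum, hS, Finset.mul_sum, Finset.mul_sum,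
        Finset.mul_sum, ← hK, ← Finset.sum_sub_distrib]
      refine (Finset.abs_sum_le_sum_abs _ _).trans ?_
      have : M * ((K : ℝ) + 1) = ∑ m ∈ Finset.range (K + 1), M := by
        rw [Finset.sum_const, Finset.card_range, nsmul_eq_mul]; push_cast; ring
      rw [this, ← Finset.sum_add_distrib]
      refine Finset.sum_le_sum fun m hm => ?_
      have h := hM (t / (1 + a⁻¹ * m)) ((one_le_div (by positivity)).2
        ((one_add_le_iff ha ht m).2 hm))
      rwa [hterm] at h
    have hKt : (K : ℝ) + 1 ≤ (a + 1) * t := by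
      have := hfl t ht
      nlinarith
    have hC' : a ^ (d + 1 + 1) / ((d + 1).factorial : ℝ) * (t * Real.log t ^ (d + 1)) =
        C * t * (a / (d + 1) * Real.log t ^ (d + 1)) := by
      rw [hC, Nat.factorial_succ]; push_cast
      field_simp
      ring
    have h2 : |C * (t * S) - a ^ (d + 1 + 1) / ((d + 1).factorial : ℝ) *
        (t * Real.log t ^ (d + 1))| ≤ C * t * Real.log t ^ d := by
      rw [hC', ← mul_assoc, ← mul_sub, abs_mul, abs_of_nonneg (mul_nonneg hC0 ht0.le)]
      refine mul_le_mul_of_nonneg_left ?_ (mul_nonneg hC0 ht0.le)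
      rw [abs_of_nonneg (by linarith)]
      linarith
    have h3 : η * (t * S) ≤ ε / 2 * (t * Real.log t ^ (d + 1)) + η * t * Real.log t ^ d := by
      calc η * (t * S) ≤ η * (t * (a / (d + 1) * Real.log t ^ (d + 1) + Real.log t ^ d)) := by
            gcongr
        _ = _ := by rw [hη]; field_simp
    have h4 : M * ((K : ℝ) + 1) ≤ M * (a + 1) * t := by
      rw [mul_assoc]; exact mul_le_mul_of_nonneg_left hKt hM0
    have h5 := hM' t ht
    -- `h6` and `h7` are the parts of `B * t * ((log t) ^ d + 1)` in `h5` that are not needed.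
    have h6 : 0 ≤ (η + C) * t := by positivity
    have h7 : 0 ≤ M * (a + 1) * t * Real.log t ^ d := by positivity
    refine (abs_sub_le _ (C * (t * S)) _).trans ?_
    linarith

/-- The number of points of the hyperbolic cross of size `t` is asymptotically
`a ^ (d + 1) / d! * t * (log t) ^ d` in dimension `d + 1`. -/
theorem tendsto_card_cross (ha : 0 < a) (d : ℕ) :
    Filter.Tendsto (fun t : ℝ => ((cross a (d + 1) t).card : ℝ) / (t * Real.log t ^ d))
      Filter.atTop (nhds (a ^ (d + 1) / d.factorial)) := by
  rw [Metric.tendsto_atTop']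
  intro ε hε
  obtain ⟨M, hM0, hM⟩ := card_cross_bound ha d (half_pos hε)
  -- Beyond `e` the denominator is at least `t`, and beyond `2 * M / ε` one has `M < ε / 2 * t`.
  refine ⟨max (Real.exp 1) (2 * M / ε), fun t ht => ?_⟩
  have ht1 : Real.exp 1 < t := (le_max_left _ _).trans_lt ht
  have ht2 : 2 * M / ε < t := (le_max_right _ _).trans_lt ht
  have ht0 : 0 < t := (Real.exp_pos _).trans ht1
  have hlog : 1 ≤ Real.log t := (Real.le_log_iff_exp_le ht0).2 ht1.le
  have hp : 1 ≤ Real.log t ^ d := one_le_pow₀ hlog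
  have ht3 : 1 ≤ t := by linarith [Real.add_one_le_exp (1 : ℝ)]
  have hD : 0 < t * Real.log t ^ d := by positivity
  have h := hM t ht3
  rw [Real.dist_eq, div_sub' hD.ne', abs_div, abs_of_pos hD, div_lt_iff₀ hD, mul_comm (t * _)]
  refine h.trans_lt ?_
  rw [div_lt_iff₀ hε] at ht2
  nlinarith

end Counting

/-! ### Inversion of the counting function -/

section Inversion

open Filter

lemma tendsto_div_log_pow {c : ℝ} (hc : 0 < c) (m : ℕ) :
    Tendsto (fun x : ℝ => x / (c * Real.log x ^ m)) atTop atTop := by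
  have h : Tendsto (fun x : ℝ => Real.log x ^ m / x) atTop (nhds 0) :=
    Asymptotics.IsLittleO.tendsto_div_nhds_zero (Real.isLittleO_pow_log_id_atTop (n := m))
  have hpos : ∀ᶠ x : ℝ in atTop, 0 < Real.log x ^ m / x := by
    filter_upwards [eventually_gt_atTop 1] with x hx
    have := Real.log_pos hx
    positivity
  have h2 : Tendsto (fun x : ℝ => (Real.log x ^ m / x)⁻¹) atTop atTop :=
    Tendsto.inv_tendsto_nhdsGT_zero (tendsto_nhdsWithin_iff.2 ⟨h, hpos⟩)
  refine (h2.const_mul_atTop (inv_pos.2 hc)).congr fun x => ?_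
  rw [inv_div, inv_mul_eq_div, div_div, mul_comm]

/-- The logarithm equals `log x - log c - m log log x`, and only its first term matters to leading
order. -/
lemma tendsto_log_div_log_pow {c : ℝ} (hc : 0 < c) (m : ℕ) :
    Tendsto (fun x : ℝ => Real.log (x / (c * Real.log x ^ m)) / Real.log x) atTop (nhds 1) := by
  have hll : Tendsto (fun x : ℝ => Real.log (Real.log x) / Real.log x) atTop (nhds 0) :=
    (Asymptotics.IsLittleO.tendsto_div_nhds_zero Real.isLittleO_log_id_atTop).comp
      Real.tendsto_log_atTop
  have hlc : Tendsto (fun x : ℝ => Real.log c / Real.log x) atTop (nhds 0) :=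
    Real.tendsto_log_atTop.const_div_atTop _
  have h := (tendsto_const_nhds (x := (1 : ℝ))).sub (hlc.add (hll.const_mul (m : ℝ)))
  simp only [mul_zero, add_zero, sub_zero] at h
  refine h.congr' ?_
  filter_upwards [eventually_gt_atTop 1] with x hx
  have hl := Real.log_pos hx
  have hx0 : x ≠ 0 := by linarith
  rw [Real.log_div hx0 (by positivity), Real.log_mul hc.ne' (by positivity), Real.log_pow]
  field_simp

/-- For `t = x / (c (log x) ^ m)` one has `t (log t) ^ m ~ x / c`. Thus whether the cross has
eventually more or fewer than `x` points is decided by comparing `c` with the counting constant, and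
no inverse function is needed. -/
lemma tendsto_card_cross_div {a : ℝ} (ha : 0 < a) (m : ℕ) {c : ℝ} (hc : 0 < c) :
    Tendsto (fun x : ℝ => ((cross a (m + 1) (x / (c * Real.log x ^ m))).card : ℝ) / x) atTop
      (nhds (a ^ (m + 1) / m.factorial / c)) := by
  have h1 := (tendsto_card_cross ha m).comp (tendsto_div_log_pow hc m)
  have h2 := (tendsto_log_div_log_pow hc m).pow m
  have h := (h1.mul h2).div_const c
  rw [one_pow, mul_one] at h
  refine h.congr' ?_
  filter_upwards [eventually_gt_atTop 1, (tendsto_div_log_pow hc m).eventually_gt_atTop 1]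
    with x hx ht
  have hl := Real.log_pos hx
  have hlt := Real.log_pos ht
  simp only [Function.comp_apply]
  set u := Real.log (x / (c * Real.log x ^ m))
  set N := ((cross a (m + 1) (x / (c * Real.log x ^ m))).card : ℝ)
  rw [div_pow]
  field_simp

end Inversion

/-! ### Approximation numbers in terms of hyperbolic crosses -/

section Cross

variable (p : Param) {s : ℝ} (hs : 0 < s) (d : ℕ)

/-- With `r = t ^ (-s)`, comparing `r ^ 2 * Λ k` with `1` amounts to comparing the product with `t`,
that is, to membership in the cross. -/
lemma rpow_neg_sq_mul_prod {t : ℝ} (ht : 0 < t) (k : Fin d → ℕ) :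
    (t ^ (-s)) ^ 2 * ∏ j, (1 + p.a⁻¹ * (k j : ℝ)) ^ (2 * s) =
      ((∏ j, (1 + p.a⁻¹ * (k j : ℝ))) / t) ^ (2 * s) := by
  have ha : 0 < p.a := p.ha
  have h0 := zero_le_one.trans (one_le_prod_one_add ha k)
  rw [Real.finsetProd_rpow _ _ (fun j _ => by positivity), Real.div_rpow h0 ht.le,
    ← Real.rpow_natCast, ← Real.rpow_mul ht.le, div_eq_inv_mul, ← Real.rpow_neg ht.le]
  congr 2
  push_cast; ring

lemma approxNumber_mixed_le {t : ℝ} (ht : 0 < t) {n : ℕ} (hn : (cross p.a d t).card < n) :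
    approxNumber (mixedJacobiEmbedding p hs d) n ≤ t ^ (-s) := by
  have ha : 0 < p.a := p.ha
  refine approxNumber_embedding_le (F := cross p.a d t) (by positivity) (fun k hk => ?_) hn
  rw [mem_cross ha, not_le] at hk
  rw [rpow_neg_sq_mul_prod p d ht]
  exact Real.one_le_rpow ((one_le_div ht).2 hk.le) (by positivity)

lemma le_approxNumber_mixed {t : ℝ} (ht : 0 < t) {n : ℕ} (hn0 : 0 < n)
    (hn : n ≤ (cross p.a d t).card) :
    t ^ (-s) ≤ approxNumber (mixedJacobiEmbedding p hs d) n := by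
  have ha : 0 < p.a := p.ha
  refine le_approxNumber_embedding (F := cross p.a d t) (fun k hk => ?_) hn0 hn
  rw [mem_cross ha] at hk
  rw [rpow_neg_sq_mul_prod p d ht]
  have h0 := zero_le_one.trans (one_le_prod_one_add ha k)
  exact Real.rpow_le_one (div_nonneg h0 ht.le) ((div_le_one ht).2 hk) (by positivity)

end Cross

/-- At the chosen size of the cross the normalized bound is an exact constant, so the only limit to
be taken is that of the point count. -/
lemma rpow_neg_mul_normalization {x c : ℝ} (hx : 1 < x) (hc : 0 < c) (m : ℕ) (s : ℝ) :
    (x / (c * Real.log x ^ m)) ^ (-s) * x ^ s * Real.log x ^ (-(s * m)) = c ^ s := by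
  have hx0 : 0 < x := by linarith
  have hl := Real.log_pos hx
  have h1 : Real.log x ^ (-(s * m)) = (Real.log x ^ m) ^ (-s) := by
    rw [← Real.rpow_natCast, ← Real.rpow_mul hl.le]; congr 1; ring
  rw [h1, Real.rpow_neg (by positivity), ← Real.inv_rpow (by positivity), Real.rpow_neg
    (by positivity), ← Real.inv_rpow (by positivity), ← Real.mul_rpow (by positivity) hx0.le,
    ← Real.mul_rpow (by positivity) (by positivity)]
  congr 1
  field_simp

end Jacobi

end

theorem mainTheorem11 (p : Jacobi.Param) (s : ℝ) (hs : 0 < s) (d : ℕ) (hd : 1 ≤ d) :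
    Filter.Tendsto
      (fun n : ℕ => Jacobi.approxNumber (Jacobi.mixedJacobiEmbedding p hs d) n *
        (n : ℝ) ^ s * Real.log n ^ (-(s * ((d : ℝ) - 1))))
      Filter.atTop (nhds ((p.a ^ d / (Nat.factorial (d - 1) : ℝ)) ^ s)) := by
  obtain ⟨m, rfl⟩ : ∃ m, d = m + 1 := ⟨d - 1, by omega⟩
  have ha : 0 < p.a := p.ha
  have hm : ((m + 1 : ℕ) : ℝ) - 1 = m := by push_cast; ring
  rw [hm, Nat.add_sub_cancel]
  set C := p.a ^ (m + 1) / (m.factorial : ℝ) with hC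
  have hC0 : 0 < C := by positivity
  have hcard : ∀ c : ℝ, 0 < c → Filter.Tendsto (fun n : ℕ =>
      ((Jacobi.cross p.a (m + 1) ((n : ℝ) / (c * Real.log n ^ m))).card : ℝ) / n)
      Filter.atTop (nhds (C / c)) := fun c hc =>
    (Jacobi.tendsto_card_cross_div ha m hc).comp tendsto_natCast_atTop_atTop
  have hbig : ∀ᶠ n : ℕ in Filter.atTop, (1 : ℝ) < n :=
    tendsto_natCast_atTop_atTop.eventually_gt_atTop 1
  -- By continuity of `c ^ s` at `C`, any `y < C ^ s` lies below `c ^ s` for some `c` in `(0, C)`.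
  -- Then the count divided by `n` tends to `C / c > 1`, so the cross eventually has more than `n`
  -- points and the lower bound applies. The second case mirrors this with `c > C` and fewer than
  -- `n` points.
  refine tendsto_order.2 ⟨fun y hy => ?_, fun y hy => ?_⟩
  · obtain ⟨c, ⟨hc0, hcC⟩, hyc⟩ : ∃ c, (0 < c ∧ c < C) ∧ y < c ^ s := by
      have hcont : Filter.Tendsto (fun c : ℝ => c ^ s) (nhdsWithin C (Set.Iio C))
          (nhds (C ^ s)) :=
        (Real.continuousAt_rpow_const C s (Or.inl hC0.ne')).tendsto.mono_left nhdsWithin_le_nhds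
      have hmem : ∀ᶠ c in nhdsWithin C (Set.Iio C), c ∈ Set.Ioo 0 C := Ioo_mem_nhdsLT hC0
      exact (hmem.and (hcont.eventually (lt_mem_nhds hy))).exists
    filter_upwards [hbig, (hcard c hc0).eventually (lt_mem_nhds ((one_lt_div hc0).2 hcC))]
      with n hn1 hn
    have hn0 : (0 : ℝ) < n := by linarith
    have hl := Real.log_pos hn1
    rw [one_lt_div hn0, Nat.cast_lt] at hn
    refine hyc.trans_le ?_
    rw [← Jacobi.rpow_neg_mul_normalization hn1 hc0 m s]
    gcongr
    exact Jacobi.le_approxNumber_mixed p hs (m + 1) (by positivity) (by exact_mod_cast hn0) hn.le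
  · obtain ⟨c, hCc, hyc⟩ : ∃ c, C < c ∧ c ^ s < y := by
      have hcont : Filter.Tendsto (fun c : ℝ => c ^ s) (nhdsWithin C (Set.Ioi C))
          (nhds (C ^ s)) :=
        (Real.continuousAt_rpow_const C s (Or.inl hC0.ne')).tendsto.mono_left nhdsWithin_le_nhds
      have hmem : ∀ᶠ c in nhdsWithin C (Set.Ioi C), C < c := self_mem_nhdsWithin
      exact (hmem.and (hcont.eventually (gt_mem_nhds hy))).exists
    have hc0 : 0 < c := hC0.trans hCc
    filter_upwards [hbig, (hcard c hc0).eventually (gt_mem_nhds ((div_lt_one hc0).2 hCc))]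
      with n hn1 hn
    have hn0 : (0 : ℝ) < n := by linarith
    have hl := Real.log_pos hn1
    rw [div_lt_one hn0, Nat.cast_lt] at hn
    refine lt_of_le_of_lt ?_ hyc
    rw [← Jacobi.rpow_neg_mul_normalization hn1 hc0 m s]
    gcongr
    exact Jacobi.approxNumber_mixed_le p hs (m + 1) (by positivity) hn
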